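/- **Theorem 2.1.** Let $M$ be a smooth manifold (finite-dimensional, Hausdorff, second countable, without boundary) with a Poisson bracket $\{\cdot,\cdot\}$, that is, an $\mathbb R$-bilinear, skew-symmetric bracket on $C^\infty(M)$ satisfying the Leibniz and Jacobi identities. A Poisson automorphism of $M$ is a diffeomorphism $\varphi:M\to M$ with $\{F_1\circ\varphi,F_2\circ\varphi\}=\{F_1,F_2\}\circ\varphi$ for all $F_1,F_2\in C^\infty(M)$. (i) Let $G$ be a compact topological group acting continuously on $M$ such that each $g\in G$ acts by a Poisson automorphism. Then $N=M^G=\{x\in M: gx=x \text{ for all } g\in G\}$ is an embedded submanifold of $M$ (its components may have different dimensions), and, with $\iota:N\hookrightarrow M$ the inclusion, there is a unique Poisson bracket $\{\cdot,\cdot\}_N$ on $C^\infty(N)$ such that $$\iota^*\{F_1,F_2\}=\{\iota^*F_1,\iota^*F_2\}_N$$ for all $G$-invariant functions $F_1,F_2\in C^\infty(M)$. (ii) The same conclusion holds for every finite group $G$ acting on $M$ by Poisson automorphisms. (iii) (Poisson involution theorem) If $\varphi:M\to M$ is a Poisson automorphism with $\varphi\circ\varphi=\mathrm{id}_M$, then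 $N=\{x\in M:\varphi(x)=x\}$ is an embedded submanifold of $M$ and there is a unique Poisson bracket $\{\cdot,\cdot\}_N$ on $C^\infty(N)$ such that $\iota^*\{F_1,F_2\}=\{\iota^*F_1,\iota^*F_2\}_N$ for all $F_1,F_2\in C^\infty(M)$ with $F_i\circ\varphi=F_i$. -/

import Mathlib

open scoped Manifold ContDiff

namespace PoissonFixed

/-- A Poisson bracket on a commutative real algebra: a real-bilinear, skew-symmetric operation which
satisfies the Leibniz and Jacobi identities. -/
@[ext]
structure PoissonStructure (A : Type*) [CommRing A] [Algebra ℝ A] where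
  /-- The bracket `{f, g}`. -/
  bracket : A →ₗ[ℝ] A →ₗ[ℝ] A
  skew : ∀ f g : A, bracket f g = -bracket g f
  leibniz : ∀ f g h : A, bracket f (g * h) = bracket f g * h + g * bracket f h
  jacobi : ∀ f g h : A,
    bracket f (bracket g h) + bracket g (bracket h f) + bracket h (bracket f g) = 0

section

variable {E : Type*} [NormedAddCommGroup E] [NormedSpace ℝ E]
variable {M : Type*} [TopologicalSpace M] [ChartedSpace E M]

/-- A Poisson automorphism of the Poisson manifold `(M, P)`: a diffeomorphism `φ` of `M` with
`{F₁ ∘ φ, F₂ ∘ φ} = {F₁, F₂} ∘ φ` for all smooth functions `F₁`, `F₂`. -/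
def IsPoissonAutomorphism (P : PoissonStructure C^∞⟮𝓘(ℝ, E), M; ℝ⟯)
    (φ : M ≃ₘ^∞⟮𝓘(ℝ, E), 𝓘(ℝ, E)⟯ M) : Prop :=
  ∀ F₁ F₂ : C^∞⟮𝓘(ℝ, E), M; ℝ⟯,
    P.bracket (F₁.comp φ.toContMDiffMap) (F₂.comp φ.toContMDiffMap) =
      (P.bracket F₁ F₂).comp φ.toContMDiffMap

/-- The group `G` acts on `(M, P)` by Poisson automorphisms: `x ↦ g • x` is a Poisson automorphism
for every `g`. -/
def ActsByPoissonAutomorphisms (G : Type*) [Group G] [MulAction G M]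
    (P : PoissonStructure C^∞⟮𝓘(ℝ, E), M; ℝ⟯) : Prop :=
  ∀ g : G, ∃ φ : M ≃ₘ^∞⟮𝓘(ℝ, E), 𝓘(ℝ, E)⟯ M,
    (∀ x : M, φ x = g • x) ∧ IsPoissonAutomorphism P φ

variable (E) in
/-- `N` is an embedded smooth submanifold of `M`: around each of its points there is a smooth chart
of `M` in which `N` is a linear subspace. The dimension of the subspace may depend on the connected
component of `N`. -/
def IsEmbeddedSubmanifold (N : Set M) : Prop :=
  ∀ x ∈ N, ∃ φ ∈ IsManifold.maximalAtlas 𝓘(ℝ, E) ∞ M, x ∈ φ.source ∧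
    ∃ V : Submodule ℝ E, ∀ y ∈ φ.source, y ∈ N ↔ φ y ∈ V

variable (E) in
/-- The algebra `C^∞(N)` of smooth functions on a subset `N` of `M`: the functions on `N` which near
each point of `N` are restrictions of smooth functions defined on open subsets of `M`. For an
embedded submanifold these are the functions that are smooth in the charts of `N`. -/
def smoothFunctions (N : Set M) : Subalgebra ℝ (N → ℝ) where
  carrier := {f | ∀ x : N, ∃ U : Set M, IsOpen U ∧ (x : M) ∈ U ∧
    ∃ F : M → ℝ, ContMDiffOn 𝓘(ℝ, E) 𝓘(ℝ, ℝ) ∞ F U ∧ ∀ y : N, (y : M) ∈ U → F y = f y}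
  mul_mem' := by
    intro a b ha hb x
    obtain ⟨U, hU, hxU, F, hF, hFa⟩ := ha x
    obtain ⟨V, hV, hxV, K, hK, hKb⟩ := hb x
    refine ⟨U ∩ V, hU.inter hV, ⟨hxU, hxV⟩, fun y => F y * K y,
      (hF.mono Set.inter_subset_left).mul (hK.mono Set.inter_subset_right), ?_⟩
    intro y hy
    simp [hFa y hy.1, hKb y hy.2]
  add_mem' := by
    intro a b ha hb x
    obtain ⟨U, hU, hxU, F, hF, hFa⟩ := ha x
    obtain ⟨V, hV, hxV, K, hK, hKb⟩ := hb x
    refine ⟨U ∩ V, hU.inter hV, ⟨hxU, hxV⟩, fun y => F y + K y,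
      (hF.mono Set.inter_subset_left).add (hK.mono Set.inter_subset_right), ?_⟩
    intro y hy
    simp [hFa y hy.1, hKb y hy.2]
  algebraMap_mem' := by
    intro r x
    exact ⟨Set.univ, isOpen_univ, Set.mem_univ _, fun _ => r, contMDiffOn_const, fun _ _ => rfl⟩

/-- The restriction `ι^* F` to `N` of a smooth function `F` on `M`. -/
noncomputable def restrict (N : Set M) (F : C^∞⟮𝓘(ℝ, E), M; ℝ⟯) : smoothFunctions E N :=
  ⟨fun y => F y, fun _ => ⟨Set.univ, isOpen_univ, Set.mem_univ _, F, F.contMDiff.contMDiffOn,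
    fun _ _ => rfl⟩⟩

end

end PoissonFixed

/-! At a fixed point a compact group of diffeomorphisms is linear in suitable coordinates (Bochner):
average `ρ(g⁻¹)(g y - y₀)` over Haar measure, where `ρ(g)` is the differential of `g` at `y₀`. In
such a chart the fixed point set is the linear subspace of `ρ`-fixed vectors, hence an embedded
submanifold.

The bracket of two functions on `N` at `x` is defined by extending both near `x` to `G`-invariant
functions on `M` and taking the bracket of the extensions at `x`. Extensions exist by cutting off
and averaging (`exists_invariant_extension`). Independence of the extensions is the central point
(`IsDerivationAt.apply_eq_zero_of_invariant`): if an invariant `F` vanishes on `N` near `x`, its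
differential at `x` is invariant and kills all fixed vectors. It takes the same value on a vector as
on the average of its orbit, which is fixed, so it is zero; by Hadamard's lemma every derivation at
`x` then kills `F`. Since the bracket of invariant functions is invariant, it is itself an invariant
extension of the new bracket, and the Poisson identities pass from `M` to `N`. Uniqueness holds
because a bracket on `C^∞(N)` is local, hence determined by restrictions of invariant functions.

The action is only jointly continuous, with each element acting smoothly. Smoothness of averages
requires joint continuity of all derivatives in the group element and the point. Baire's theorem
gives this for first derivatives at one group element, translation in the group gives it everywhere
(`IsLocalAction.continuousOn_fderiv`), and passing to the tangent bundle repeatedly gives it in all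
orders. -/

namespace PoissonFixed

open Set Filter Topology MeasureTheory Function

/-! ### Smoothness of integrals over a compact parameter space. -/

section ParametricIntegral

universe u v w

variable {K : Type v} [TopologicalSpace K] {F : Type w} [NormedAddCommGroup F] [NormedSpace ℝ F]

/-- The family `h k`, `k : K`, of functions on `Ω` is `n` times differentiable, and its iterated
directional derivatives up to order `n` are jointly continuous on `K × Ω`. -/
def JointlyContDiffOn : ℕ → ∀ {E : Type u} [NormedAddCommGroup E] [NormedSpace ℝ E],
    (K → E → F) → Set E → Prop
  | 0, _, _, _, h, Ω => ContinuousOn (uncurry h) (univ ×ˢ Ω)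
  | n + 1, E, _, _, h, Ω => ContinuousOn (uncurry h) (univ ×ˢ Ω) ∧
      (∀ k, DifferentiableOn ℝ (h k) Ω) ∧
      -- The derivative is recorded as an `F`-valued function on `E × E`, so the target never
      -- changes and the recursion matches iterated tangent lifts.
      JointlyContDiffOn n (fun k (p : E × E) => fderiv ℝ (h k) p.1 p.2) (Ω ×ˢ (univ : Set E))

theorem JointlyContDiffOn.continuousOn {n : ℕ} {E : Type u} [NormedAddCommGroup E]
    [NormedSpace ℝ E] {h : K → E → F} {Ω : Set E} (H : JointlyContDiffOn n h Ω) :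
    ContinuousOn (uncurry h) (univ ×ˢ Ω) := by
  cases n with
  | zero => exact H
  | succ n => exact H.1

theorem continuous_slice {α : Type*} [TopologicalSpace α] {X : Type*} [TopologicalSpace X]
    {h : K → X → α} {Ω : Set X} (hc : ContinuousOn (uncurry h) (univ ×ˢ Ω)) {x : X} (hx : x ∈ Ω) :
    Continuous fun k => h k x :=
  hc.comp_continuous (f := fun k => (k, x)) (by fun_prop) fun _ => ⟨trivial, hx⟩

/-- A locally uniform bound for a family which is jointly continuous on `K × Ω`, `K` compact. -/
theorem exists_nhds_norm_le [CompactSpace K] {α : Type*} [NormedAddCommGroup α] {E : Type u}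
    [NormedAddCommGroup E] [NormedSpace ℝ E] [FiniteDimensional ℝ E] {h : K → E → α} {Ω : Set E} (hΩ : IsOpen Ω)
    (hc : ContinuousOn (uncurry h) (univ ×ˢ Ω)) {x : E} (hx : x ∈ Ω) :
    ∃ s ∈ 𝓝 x, s ⊆ Ω ∧ ∃ C : ℝ, ∀ k, ∀ y ∈ s, ‖h k y‖ ≤ C := by
  have : ProperSpace E := FiniteDimensional.proper ℝ E
  obtain ⟨s, hs, hsΩ, hsc⟩ := local_compact_nhds (hΩ.mem_nhds hx)
  obtain ⟨C, hC⟩ := (isCompact_univ.prod hsc).exists_bound_of_continuousOn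
    (hc.mono (prod_mono subset_rfl hsΩ))
  exact ⟨s, hs, hsΩ, C, fun k y hy => hC (k, y) ⟨trivial, hy⟩⟩

theorem JointlyContDiffOn.congr {n : ℕ} {E : Type u} [NormedAddCommGroup E] [NormedSpace ℝ E]
    {h h' : K → E → F} {Ω : Set E} (hΩ : IsOpen Ω) (H : JointlyContDiffOn n h Ω)
    (heq : ∀ k, EqOn (h' k) (h k) Ω) : JointlyContDiffOn n h' Ω := by
  have hc : ContinuousOn (uncurry h') (univ ×ˢ Ω) :=
    H.continuousOn.congr fun p hp => heq p.1 hp.2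
  induction n generalizing E with
  | zero => exact hc
  | succ n ih =>
    have hD : ∀ k, EqOn (fun p : E × E => fderiv ℝ (h' k) p.1 p.2)
        (fun p : E × E => fderiv ℝ (h k) p.1 p.2) (Ω ×ˢ univ) := fun k p hp => by
      change fderiv ℝ (h' k) p.1 p.2 = fderiv ℝ (h k) p.1 p.2
      rw [((heq k).eventuallyEq_of_mem (hΩ.mem_nhds hp.1)).fderiv_eq]
    refine ⟨hc, fun k => (H.2.1 k).congr (heq k), ih (hΩ.prod isOpen_univ) H.2.2 hD ?_⟩
    exact H.2.2.continuousOn.congr fun p hp => hD p.1 hp.2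

theorem contDiffOn_fderiv_apply {E : Type u} [NormedAddCommGroup E] [NormedSpace ℝ E]
    {f : E → F} {Ω : Set E} (hΩ : IsOpen Ω) (hf : ContDiffOn ℝ ∞ f Ω) :
    ContDiffOn ℝ ∞ (fun p : E × E => fderiv ℝ f p.1 p.2) (Ω ×ˢ (univ : Set E)) := by
  have h : ContDiffOn ℝ ∞ (fderiv ℝ f) Ω := hf.fderiv_of_isOpen hΩ (by simp)
  exact (h.comp contDiffOn_fst fun p hp => hp.1).clm_apply contDiffOn_snd

/-- By the chain rule the derivative again has this form, with `T k` replaced by `T k × T k` and `f`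
by its tangent derivative. The dilations `T t = t • id` are the case needed for Hadamard's lemma. -/
theorem jointlyContDiffOn_comp_clm {E E' : Type u} [NormedAddCommGroup E] [NormedSpace ℝ E]
    [NormedAddCommGroup E'] [NormedSpace ℝ E']
    {f : E' → F} {Ω' : Set E'} (hΩ' : IsOpen Ω')
    (hf : ContDiffOn ℝ ∞ f Ω') {T : K → E →L[ℝ] E'} (hT : Continuous T) {Ω : Set E}
    (hΩ : IsOpen Ω) (hm : ∀ k, MapsTo (T k) Ω Ω') (n : ℕ) :
    JointlyContDiffOn n (fun k x => f (T k x)) Ω := by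
  have hc : ContinuousOn (uncurry fun k x => f (T k x)) (univ ×ˢ Ω) :=
    hf.continuousOn.comp (f := fun p : K × E => T p.1 p.2)
      (Continuous.continuousOn (by fun_prop)) fun p hp => hm _ hp.2
  induction n generalizing E E' with
  | zero => exact hc
  | succ n ih =>
    refine ⟨hc, fun k => (hf.differentiableOn (by simp)).comp
      (T k).differentiable.differentiableOn (hm k), ?_⟩
    have hT' : Continuous fun k => (T k).prodMap (T k) := hT.prod_mapL ℝ hT
    refine (ih (hΩ'.prod isOpen_univ) (contDiffOn_fderiv_apply hΩ' hf) hT'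
      (hΩ.prod isOpen_univ) (fun k p hp => ⟨hm k hp.1, trivial⟩) ?_).congr
      (hΩ.prod isOpen_univ) fun k p hp => ?_
    · exact (contDiffOn_fderiv_apply hΩ' hf).continuousOn.comp
        (f := fun p : K × (E × E) => (T p.1 p.2.1, T p.1 p.2.2))
        (Continuous.continuousOn (by fun_prop)) fun p hp => ⟨hm _ hp.2.1, trivial⟩
    · have h1 : HasFDerivAt f (fderiv ℝ f (T k p.1)) (T k p.1) :=
        (hf.differentiableOn (by simp)).differentiableAt
          (hΩ'.mem_nhds (hm k hp.1)) |>.hasFDerivAt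
      have := (h1.comp p.1 (T k).hasFDerivAt).fderiv
      change fderiv ℝ (f ∘ T k) p.1 p.2 = _
      rw [this]
      rfl

variable {E : Type u} [NormedAddCommGroup E] [NormedSpace ℝ E] [FiniteDimensional ℝ E]
  [CompactSpace K] [MeasurableSpace K] [BorelSpace K] {μ : Measure K} [IsFiniteMeasure μ]

theorem integrable_of_continuous_of_compactSpace [FiniteDimensional ℝ F] {f : K → F}
    (hf : Continuous f) : Integrable f μ := by
  have : ProperSpace F := FiniteDimensional.proper ℝ F
  obtain ⟨C, hC⟩ := isCompact_univ.exists_bound_of_continuousOn hf.continuousOn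
  exact Integrable.of_bound hf.aestronglyMeasurable C (Eventually.of_forall fun k => hC k trivial)

/-- Compactness of `K` and local compactness of `E` bound the derivatives near `x` by a constant,
which is integrable because `μ` is finite. -/
theorem hasFDerivAt_integral_of_continuousOn [FiniteDimensional ℝ F] {h : K → E → F} {Ω : Set E}
    (hΩ : IsOpen Ω) (hc : ContinuousOn (uncurry h) (univ ×ˢ Ω))
    (hd : ∀ k, DifferentiableOn ℝ (h k) Ω)
    (hc' : ContinuousOn (uncurry fun k y => fderiv ℝ (h k) y) (univ ×ˢ Ω)) {x : E} (hx : x ∈ Ω) :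
    HasFDerivAt (fun y => ∫ k, h k y ∂μ) (∫ k, fderiv ℝ (h k) x ∂μ) x := by
  obtain ⟨s, hs, hsΩ, C, hC⟩ := exists_nhds_norm_le hΩ hc' hx
  refine hasFDerivAt_integral_of_dominated_of_fderiv_le (F := fun y k => h k y)
    (F' := fun y k => fderiv ℝ (h k) y) (bound := fun _ => C) hs ?_
    (integrable_of_continuous_of_compactSpace (continuous_slice hc hx))
    (integrable_of_continuous_of_compactSpace (continuous_slice hc' hx)).aestronglyMeasurable
    (Eventually.of_forall hC) (integrable_const C) (Eventually.of_forall fun k y hy => ?_)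
  · filter_upwards [hΩ.mem_nhds hx] with y hy
    exact (integrable_of_continuous_of_compactSpace (continuous_slice hc hy)).aestronglyMeasurable
  · exact ((hd k).differentiableAt (hΩ.mem_nhds (hsΩ hy))).hasFDerivAt

theorem continuousOn_integral_of_continuousOn [FiniteDimensional ℝ F] {h : K → E → F} {Ω : Set E}
    (hΩ : IsOpen Ω) (hc : ContinuousOn (uncurry h) (univ ×ˢ Ω)) :
    ContinuousOn (fun y => ∫ k, h k y ∂μ) Ω := by
  intro x hx
  obtain ⟨s, hs, hsΩ, C, hC⟩ := exists_nhds_norm_le hΩ hc hx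
  refine ContinuousAt.continuousWithinAt ?_
  refine continuousAt_of_dominated (bound := fun _ => C) ?_ ?_ (integrable_const C) ?_
  · filter_upwards [hs] with y hy
    exact (integrable_of_continuous_of_compactSpace
      (continuous_slice hc (hsΩ hy))).aestronglyMeasurable
  · filter_upwards [hs] with y hy
    exact Eventually.of_forall fun k => hC k y hy
  · refine Eventually.of_forall fun k => ?_
    have : ContinuousOn (fun y => h k y) Ω :=
      hc.comp (f := fun y => (k, y)) (by fun_prop) fun y hy => ⟨trivial, hy⟩
    exact this.continuousAt (hΩ.mem_nhds hx)

/-- A parametric integral over a compact space of a jointly `C^n` family is `C^n`. -/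
theorem JointlyContDiffOn.contDiffOn_integral [FiniteDimensional ℝ F] {n : ℕ} {h : K → E → F}
    {Ω : Set E} (hΩ : IsOpen Ω) (H : JointlyContDiffOn n h Ω) :
    ContDiffOn ℝ n (fun y => ∫ k, h k y ∂μ) Ω := by
  induction n generalizing E with
  | zero => exact contDiffOn_zero.2 (continuousOn_integral_of_continuousOn hΩ H)
  | succ n ih =>
    obtain ⟨hc, hd, H'⟩ := H
    have hc' : ContinuousOn (uncurry fun k y => fderiv ℝ (h k) y) (univ ×ˢ Ω) := by
      -- In finite dimension, continuity of each directional derivative gives continuity in operator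
      -- norm.
      refine continuousOn_clm_apply.2 fun v => ?_
      exact H'.continuousOn.comp (f := fun p : K × E => (p.1, (p.2, v))) (by fun_prop)
        fun p hp => ⟨trivial, hp.2, trivial⟩
    have hD := fun x (hx : x ∈ Ω) => hasFDerivAt_integral_of_continuousOn (μ := μ) hΩ hc hd hc' hx
    have := ih (hΩ.prod isOpen_univ) H'
    push_cast
    refine (contDiffOn_succ_iff_fderiv_of_isOpen hΩ).2
      ⟨fun x hx => (hD x hx).differentiableAt.differentiableWithinAt, by simp, ?_⟩
    refine contDiffOn_clm_apply.2 fun v => ?_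
    refine (this.comp (f := fun y : E => (y, v)) (by fun_prop)
      (fun y hy => ⟨hy, trivial⟩)).congr fun y hy => ?_
    rw [(hD y hy).fderiv, ContinuousLinearMap.integral_apply
      (integrable_of_continuous_of_compactSpace (continuous_slice hc' hy))]
    rfl

end ParametricIntegral

/-! ### Joint continuity of derivatives by Baire category. -/

section SeparatelySmooth

variable {K : Type*} [TopologicalSpace K] {E F : Type*} [NormedAddCommGroup E]
  [NormedSpace ℝ E] [NormedAddCommGroup F] [NormedSpace ℝ F]

/-- By Baire's theorem, the derivatives at points near `x₀` of a separately continuous and `C^1`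
family are equicontinuous at `x₀` for parameters near a suitable `k₀`. -/
theorem exists_equicontinuousAt_fderiv [BaireSpace K] [Nonempty K] {h : K → E → F} {Ω : Set E}
    (hΩ : IsOpen Ω) (hc : ∀ x ∈ Ω, Continuous fun k => h k x)
    (hd : ∀ k, ContDiffOn ℝ ∞ (h k) Ω) {x₀ : E} (hx₀ : x₀ ∈ Ω) :
    ∃ k₀, ∀ ε > 0, ∃ W ∈ 𝓝 k₀, ∃ r > 0, Metric.ball x₀ r ⊆ Ω ∧ ∀ k ∈ W, ∀ x ∈ Metric.ball x₀ r,
      ‖fderiv ℝ (h k) x - fderiv ℝ (h k) x₀‖ ≤ ε := by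
  obtain ⟨r₀, hr₀, hball⟩ := Metric.isOpen_iff.1 hΩ x₀ hx₀
  have hr : ∀ m : ℕ, 0 < r₀ / (m + 1) := fun m => by positivity
  have hsub : ∀ m : ℕ, Metric.ball x₀ (r₀ / (m + 1)) ⊆ Ω := fun m =>
    (Metric.ball_subset_ball (div_le_self hr₀.le (by simp))).trans hball
  -- Equicontinuity of the derivative is expressed by increments of `h k` alone: these depend
  -- continuously on `k`, which makes the sets closed.
  let A : ℕ → ℕ → Set K := fun n m => {k | ∀ x y : E, x ∈ Metric.ball x₀ (r₀ / (m + 1)) →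
    x + y ∈ Metric.ball x₀ (r₀ / (m + 1)) → x₀ + y ∈ Metric.ball x₀ (r₀ / (m + 1)) →
    ‖(h k (x + y) - h k x) - (h k (x₀ + y) - h k x₀)‖ ≤ 1 / ((n : ℝ) + 1) * ‖y‖}
  have hA : ∀ n m, IsClosed (A n m) := by
    intro n m
    simp only [A, ofPred_forall]
    refine isClosed_iInter fun x => isClosed_iInter fun y => isClosed_iInter fun h1 =>
      isClosed_iInter fun h2 => isClosed_iInter fun h3 => ?_
    have c1 := hc _ (hsub m h1)
    have c2 := hc _ (hsub m h2)
    have c3 := hc _ (hsub m h3)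
    have c4 := hc _ hx₀
    exact isClosed_le (by fun_prop) continuous_const
  have hU : ∀ n, ⋃ m, A n m = univ := by
    intro n
    refine eq_univ_of_forall fun k => mem_iUnion.2 ?_
    have hs : HasStrictFDerivAt (h k) (fderiv ℝ (h k) x₀) x₀ :=
      ((hd k).contDiffAt (hΩ.mem_nhds hx₀)).hasStrictFDerivAt (by simp)
    -- Half the tolerance, because the increments at `x` and at `x₀` are both compared with the same
    -- linear map.
    have hε : 0 < 1 / ((n : ℝ) + 1) / 2 := by positivity
    obtain ⟨δ, hδ, hb⟩ := Metric.eventually_nhds_iff_ball.1 (hs.isLittleO.def hε)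
    obtain ⟨m, hm⟩ := exists_nat_gt (r₀ / δ)
    have hmδ : r₀ / (m + 1) < δ := by
      rw [div_lt_iff₀ hδ] at hm
      rw [div_lt_iff₀ (by positivity)]
      nlinarith
    have hb' : ∀ x y : E, x ∈ Metric.ball x₀ (r₀ / (m + 1)) → x + y ∈ Metric.ball x₀ (r₀ / (m + 1)) →
        ‖h k (x + y) - h k x - fderiv ℝ (h k) x₀ y‖ ≤ 1 / ((n : ℝ) + 1) / 2 * ‖y‖ := by
      intro x y h1 h2
      have := hb (x + y, x) (by
        rw [← ball_prod_same]
        exact ⟨Metric.ball_subset_ball hmδ.le h2, Metric.ball_subset_ball hmδ.le h1⟩)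
      simpa using this
    refine ⟨m, fun x y h1 h2 h3 => ?_⟩
    have e1 := hb' x y h1 h2
    have e2 := hb' x₀ y (Metric.mem_ball_self (hr m)) h3
    calc _ = ‖(h k (x + y) - h k x - fderiv ℝ (h k) x₀ y) -
          (h k (x₀ + y) - h k x₀ - fderiv ℝ (h k) x₀ y)‖ := by congr 1; abel
      _ ≤ _ := (norm_sub_le _ _).trans (by linarith)
  have hdense : Dense (⋂ n, ⋃ m, interior (A n m)) :=
    dense_iInter_of_isOpen (fun n => isOpen_iUnion fun m => isOpen_interior)
      fun n => dense_iUnion_interior_of_closed (hA n) (hU n)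
  obtain ⟨k₀, hk₀⟩ := hdense.nonempty
  refine ⟨k₀, fun ε hε => ?_⟩
  obtain ⟨n, hn⟩ := exists_nat_one_div_lt hε
  obtain ⟨m, hm⟩ := mem_iUnion.1 (mem_iInter.1 hk₀ n)
  refine ⟨_, mem_interior_iff_mem_nhds.1 hm, _, hr m, hsub m, fun k hk x hx => ?_⟩
  have hdiff : ∀ z ∈ Ω, HasFDerivAt (fun y => h k (z + y) - h k z) (fderiv ℝ (h k) z) 0 := by
    intro z hz
    have h1 : HasFDerivAt (h k) (fderiv ℝ (h k) z) (z + 0) := by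
      rw [add_zero]
      exact (((hd k).differentiableOn (by simp)).differentiableAt (hΩ.mem_nhds hz)).hasFDerivAt
    simpa using (h1.comp (0 : E) ((hasFDerivAt_id (0 : E)).const_add z)).sub_const (h k z)
  -- The difference of the derivatives is the derivative at `0` of the difference of increments, so
  -- a Lipschitz bound at `0` bounds its norm.
  refine ((hdiff x (hsub m hx)).sub (hdiff x₀ hx₀)).le_of_lip' hε.le ?_
  have ht : ∀ z ∈ Metric.ball x₀ (r₀ / (m + 1)),
      ∀ᶠ y in 𝓝 (0 : E), z + y ∈ Metric.ball x₀ (r₀ / (m + 1)) := fun z hz =>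
    (continuous_const.add continuous_id).continuousAt.preimage_mem_nhds
      (Metric.isOpen_ball.mem_nhds (by simpa using hz))
  filter_upwards [ht x hx, ht x₀ (Metric.mem_ball_self (hr m))] with y h1 h2
  have := hk x y hx h1 h2
  simp only [Pi.sub_apply, add_zero, sub_self, sub_zero]
  exact this.trans (mul_le_mul_of_nonneg_right hn.le (norm_nonneg y))

/-- For some `k₀`, the derivatives of the family are jointly continuous at `(k₀, x₀)`. -/
theorem exists_continuousAt_fderiv_apply [BaireSpace K] [Nonempty K] {h : K → E → F} {Ω : Set E}
    (hΩ : IsOpen Ω) (hc : ∀ x ∈ Ω, Continuous fun k => h k x)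
    (hd : ∀ k, ContDiffOn ℝ ∞ (h k) Ω) {x₀ : E} (hx₀ : x₀ ∈ Ω) :
    ∃ k₀, ∀ v, ContinuousAt (fun p : K × E => fderiv ℝ (h p.1) p.2 v) (k₀, x₀) := by
  obtain ⟨k₀, hk₀⟩ := exists_equicontinuousAt_fderiv hΩ hc hd hx₀
  refine ⟨k₀, fun v => Metric.tendsto_nhds.2 fun ε hε => ?_⟩
  -- Four errors of size at most `ε / 4` will be added, three of them of the form `η * ‖v‖`; the `+
  -- 1` allows `v = 0`.
  have hη : 0 < ε / (4 * (‖v‖ + 1)) := by positivity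
  obtain ⟨W, hW, r, hr, hrΩ, hb⟩ := hk₀ _ hη
  set η := ε / (4 * (‖v‖ + 1)) with hηdef
  -- The derivative along `v` is compared with a difference quotient of fixed step `s`, which is
  -- continuous in `k` by hypothesis.
  obtain ⟨s, hs, hsr⟩ : ∃ s > 0, s * ‖v‖ < r := by
    refine ⟨r / (‖v‖ + 1), by positivity, ?_⟩
    rw [div_mul_eq_mul_div, div_lt_iff₀ (by positivity)]
    nlinarith
  have hx₀b : x₀ ∈ Metric.ball x₀ r := Metric.mem_ball_self hr
  have hy : x₀ + s • v ∈ Metric.ball x₀ r := by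
    simpa [norm_smul, abs_of_pos hs] using hsr
  have hmv : ∀ k ∈ W, ‖h k (x₀ + s • v) - h k x₀ - fderiv ℝ (h k) x₀ (s • v)‖ ≤ η * (s * ‖v‖) := by
    intro k hk
    have := (convex_ball x₀ r).norm_image_sub_le_of_norm_fderiv_le' (𝕜 := ℝ) (f := h k)
      (fun x hx => ((hd k).differentiableOn (by simp)).differentiableAt (hΩ.mem_nhds (hrΩ hx)))
      (hb k hk) hx₀b hy
    simpa [norm_smul, abs_of_pos hs] using this
  have hΔ : ∀ᶠ k in 𝓝 k₀, ‖(h k (x₀ + s • v) - h k x₀) - (h k₀ (x₀ + s • v) - h k₀ x₀)‖ <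
      s * (ε / 4) := by
    have c1 := hc _ (hrΩ hy)
    have c2 := hc _ hx₀
    have : Continuous fun k =>
      ‖(h k (x₀ + s • v) - h k x₀) - (h k₀ (x₀ + s • v) - h k₀ x₀)‖ := by fun_prop
    exact this.continuousAt.eventually_lt continuousAt_const (by simpa using by positivity)
  rw [nhds_prod_eq]
  filter_upwards [prod_mem_prod (inter_mem hW hΔ) (Metric.ball_mem_nhds x₀ hr)] with p hp
  obtain ⟨⟨hpW, hpΔ⟩, hpx⟩ := hp
  have e1 : ‖(fderiv ℝ (h p.1) p.2 - fderiv ℝ (h p.1) x₀) (s • v)‖ ≤ η * (s * ‖v‖) := by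
    refine (ContinuousLinearMap.le_of_opNorm_le _ (hb p.1 hpW p.2 hpx) _).trans_eq ?_
    simp [norm_smul, abs_of_pos hs]
  have e2 := hmv p.1 hpW
  have e3 := hmv k₀ (mem_of_mem_nhds hW)
  have hηv : η * ‖v‖ ≤ ε / 4 := by
    rw [hηdef, div_mul_eq_mul_div, div_le_div_iff₀ (by positivity) (by positivity)]
    nlinarith [norm_nonneg v]
  have key : ‖s • (fderiv ℝ (h p.1) p.2 v - fderiv ℝ (h k₀) x₀ v)‖ < s * ε := by
    calc _ = ‖(fderiv ℝ (h p.1) p.2 - fderiv ℝ (h p.1) x₀) (s • v)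
            - (h p.1 (x₀ + s • v) - h p.1 x₀ - fderiv ℝ (h p.1) x₀ (s • v))
            + ((h p.1 (x₀ + s • v) - h p.1 x₀) - (h k₀ (x₀ + s • v) - h k₀ x₀))
            + (h k₀ (x₀ + s • v) - h k₀ x₀ - fderiv ℝ (h k₀) x₀ (s • v))‖ := by
          congr 1
          simp only [sub_apply, map_smul, smul_sub]
          abel
      _ ≤ η * (s * ‖v‖) + η * (s * ‖v‖)
          + ‖(h p.1 (x₀ + s • v) - h p.1 x₀) - (h k₀ (x₀ + s • v) - h k₀ x₀)‖
          + η * (s * ‖v‖) := by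
          refine (norm_add_le _ _).trans (add_le_add ((norm_add_le _ _).trans
            (add_le_add ((norm_sub_le _ _).trans (add_le_add e1 e2)) le_rfl)) e3)
      _ < η * (s * ‖v‖) + η * (s * ‖v‖) + s * (ε / 4) + η * (s * ‖v‖) := by
          gcongr
          exact hpΔ
      _ ≤ s * ε := by nlinarith
  rw [norm_smul, Real.norm_of_nonneg hs.le] at key
  rw [dist_eq_norm]
  exact lt_of_mul_lt_mul_left key hs.le

end SeparatelySmooth

/-! ### Continuous actions by smooth maps and their tangent lifts. -/

section LocalAction

universe u

variable {G : Type*} [Group G] [TopologicalSpace G]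

/-- A continuous action of `G` on an open subset `Ω` of a normed space by smooth maps. -/
structure IsLocalAction {E : Type*} [NormedAddCommGroup E] [NormedSpace ℝ E] (a : G → E → E)
    (Ω : Set E) : Prop where
  isOpen : IsOpen Ω
  mapsTo : ∀ g, MapsTo (a g) Ω Ω
  one : ∀ x ∈ Ω, a 1 x = x
  mul : ∀ g h, ∀ x ∈ Ω, a (g * h) x = a g (a h x)
  continuousOn : ContinuousOn (uncurry a) (univ ×ˢ Ω)
  contDiffOn : ∀ g, ContDiffOn ℝ ∞ (a g) Ω

namespace IsLocalAction

variable {E : Type u} [NormedAddCommGroup E] [NormedSpace ℝ E] {a : G → E → E} {Ω : Set E}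

theorem hasFDerivAt (H : IsLocalAction a Ω) (g : G) {x : E} (hx : x ∈ Ω) :
    HasFDerivAt (a g) (fderiv ℝ (a g) x) x :=
  (((H.contDiffOn g).differentiableOn (by simp)).differentiableAt
    (H.isOpen.mem_nhds hx)).hasFDerivAt

theorem fderiv_mul (H : IsLocalAction a Ω) (g h : G) {x : E} (hx : x ∈ Ω) :
    fderiv ℝ (a (g * h)) x = (fderiv ℝ (a g) (a h x)).comp (fderiv ℝ (a h) x) := by
  have h1 : a (g * h) =ᶠ[𝓝 x] a g ∘ a h :=
    eventuallyEq_of_mem (H.isOpen.mem_nhds hx) (H.mul g h)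
  rw [h1.fderiv_eq]
  exact ((H.hasFDerivAt g (H.mapsTo h hx)).comp x (H.hasFDerivAt h hx)).fderiv

theorem fderiv_one (H : IsLocalAction a Ω) {x : E} (hx : x ∈ Ω) :
    fderiv ℝ (a 1) x = ContinuousLinearMap.id ℝ E := by
  have h1 : a 1 =ᶠ[𝓝 x] id := eventuallyEq_of_mem (H.isOpen.mem_nhds hx) H.one
  rw [h1.fderiv_eq, fderiv_id]

theorem fderiv_mul_of_fixed (H : IsLocalAction a Ω) {y₀ : E} (hy₀ : y₀ ∈ Ω)
    (hfix : ∀ g, a g y₀ = y₀) (g h : G) :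
    fderiv ℝ (a (g * h)) y₀ = (fderiv ℝ (a g) y₀).comp (fderiv ℝ (a h) y₀) := by
  rw [H.fderiv_mul g h hy₀, hfix]

/-- A compact group is a Baire space, so the derivatives are jointly continuous at `(g₁, x₀)` for
some `g₁`. Writing `g = k (k⁻¹ g)` with `k = g₀ g₁⁻¹` carries this to `(g₀, x₀)`: the outer factor
is the single smooth map `a k`, and `k⁻¹ g` is near `g₁` when `g` is near `g₀`. -/
theorem continuousOn_fderiv [IsTopologicalGroup G] [CompactSpace G] [FiniteDimensional ℝ E]
    (H : IsLocalAction a Ω) :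
    ContinuousOn (uncurry fun g x => fderiv ℝ (a g) x) (univ ×ˢ Ω) := by
  rintro ⟨g₀, x₀⟩ ⟨-, hx₀⟩
  refine ContinuousAt.continuousWithinAt ?_
  have hslice : ∀ x ∈ Ω, Continuous fun g => a g x := fun x hx => continuous_slice H.continuousOn hx
  obtain ⟨g₁, hg₁⟩ := exists_continuousAt_fderiv_apply H.isOpen hslice H.contDiffOn hx₀
  have hat : ContinuousAt (fun p : G × E => fderiv ℝ (a p.1) p.2) (g₁, x₀) :=
    continuousAt_clm_apply.2 hg₁
  set k := g₀ * g₁⁻¹ with hk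
  have hkg : k⁻¹ * g₀ = g₁ := by simp [hk]
  have hmem : ∀ᶠ p : G × E in 𝓝 (g₀, x₀), p.2 ∈ Ω :=
    continuous_snd.continuousAt.preimage_mem_nhds (H.isOpen.mem_nhds hx₀)
  have heq : (uncurry fun g x => fderiv ℝ (a g) x) =ᶠ[𝓝 (g₀, x₀)] fun p : G × E =>
      (fderiv ℝ (a k) (a (k⁻¹ * p.1) p.2)).comp (fderiv ℝ (a (k⁻¹ * p.1)) p.2) := by
    filter_upwards [hmem] with p hp
    rw [← H.fderiv_mul _ _ hp, mul_inv_cancel_left]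
    rfl
  refine ContinuousAt.congr ?_ heq.symm
  have hm : ContinuousAt (fun p : G × E => (k⁻¹ * p.1, p.2)) (g₀, x₀) := by fun_prop
  have h1 : ContinuousAt (fun p : G × E => fderiv ℝ (a (k⁻¹ * p.1)) p.2) (g₀, x₀) :=
    ContinuousAt.comp (f := fun p : G × E => (k⁻¹ * p.1, p.2))
      (g := fun p : G × E => fderiv ℝ (a p.1) p.2) (by rw [hkg]; exact hat) hm
  have h2 : ContinuousAt (fun p : G × E => a (k⁻¹ * p.1) p.2) (g₀, x₀) :=
    ContinuousAt.comp (f := fun p : G × E => (k⁻¹ * p.1, p.2)) (g := uncurry a)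
      (H.continuousOn.continuousAt ((isOpen_univ.prod H.isOpen).mem_nhds ⟨trivial, hx₀⟩)) hm
  have h3 : ContinuousAt (fderiv ℝ (a k)) (a (k⁻¹ * g₀) x₀) :=
    ((H.contDiffOn k).continuousOn_fderiv_of_isOpen H.isOpen (by simp)).continuousAt
      (H.isOpen.mem_nhds (H.mapsTo _ hx₀))
  exact (ContinuousAt.comp (f := fun p : G × E => a (k⁻¹ * p.1) p.2) h3 h2).clm_comp h1

/-- The lift of a local action to the tangent bundle. -/
theorem tangent [IsTopologicalGroup G] [CompactSpace G] [FiniteDimensional ℝ E]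
    (H : IsLocalAction a Ω) :
    IsLocalAction (fun g (p : E × E) => (a g p.1, fderiv ℝ (a g) p.1 p.2)) (Ω ×ˢ univ) where
  isOpen := H.isOpen.prod isOpen_univ
  mapsTo g p hp := ⟨H.mapsTo g hp.1, trivial⟩
  one p hp := by simp [H.one _ hp.1, H.fderiv_one hp.1]
  mul g h p hp := by simp [H.mul _ _ _ hp.1, H.fderiv_mul _ _ hp.1]
  continuousOn := by
    refine ContinuousOn.prodMk ?_ ?_
    · exact H.continuousOn.comp (f := fun p : G × (E × E) => (p.1, p.2.1)) (by fun_prop)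
        fun p hp => ⟨trivial, hp.2.1⟩
    · refine ContinuousOn.clm_apply ?_ (by fun_prop)
      exact H.continuousOn_fderiv.comp (f := fun p : G × (E × E) => (p.1, p.2.1)) (by fun_prop)
        fun p hp => ⟨trivial, hp.2.1⟩
  contDiffOn g := ((H.contDiffOn g).comp contDiffOn_fst fun p hp => hp.1).prodMk
    (contDiffOn_fderiv_apply H.isOpen (H.contDiffOn g))

/-- Differentiation replaces the action by its tangent lift and `f` by its tangent derivative,
leaving the coefficients `c` unchanged; thus first-order continuity for every action suffices for
all orders. -/
theorem jointlyContDiffOn [IsTopologicalGroup G] [CompactSpace G] [FiniteDimensional ℝ E]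
    {F F' : Type*} [NormedAddCommGroup F] [NormedSpace ℝ F] [NormedAddCommGroup F']
    [NormedSpace ℝ F'] (H : IsLocalAction a Ω) {f : E → F} (hf : ContDiffOn ℝ ∞ f Ω)
    {c : G → F →L[ℝ] F'} (hc : Continuous c) (n : ℕ) :
    JointlyContDiffOn n (fun g x => c g (f (a g x))) Ω := by
  have hcont : ContinuousOn (uncurry fun g x => c g (f (a g x))) (univ ×ˢ Ω) := by
    refine ContinuousOn.clm_apply (by fun_prop) ?_
    exact hf.continuousOn.comp H.continuousOn fun p hp => H.mapsTo _ hp.2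
  induction n generalizing E with
  | zero => exact hcont
  | succ n ih =>
    have hD : ∀ g, ∀ x ∈ Ω, HasFDerivAt (fun x => c g (f (a g x)))
        ((c g).comp ((fderiv ℝ f (a g x)).comp (fderiv ℝ (a g) x))) x := fun g x hx =>
      (c g).hasFDerivAt.comp x ((((hf.differentiableOn (by simp)).differentiableAt
        (H.isOpen.mem_nhds (H.mapsTo g hx))).hasFDerivAt).comp x (H.hasFDerivAt g hx))
    refine ⟨hcont, fun g x hx => (hD g x hx).differentiableAt.differentiableWithinAt, ?_⟩
    have hf' := contDiffOn_fderiv_apply H.isOpen hf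
    refine (ih H.tangent hf' ?_).congr H.tangent.isOpen fun g p hp => ?_
    · refine ContinuousOn.clm_apply (by fun_prop) ?_
      exact hf'.continuousOn.comp H.tangent.continuousOn fun p hp => H.tangent.mapsTo _ hp.2
    · change fderiv ℝ (fun x => c g (f (a g x))) p.1 p.2 = _
      rw [(hD g p.1 hp.1).fderiv]
      rfl

end IsLocalAction

end LocalAction

/-- The tube lemma. It provides open invariant neighbourhoods. -/
theorem isOpen_inter_setOf_forall_mem {K X Y : Type*} [TopologicalSpace K] [CompactSpace K]
    [TopologicalSpace X] [TopologicalSpace Y] {h : K → X → Y} {Ω : Set X} (hΩ : IsOpen Ω)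
    (hc : ContinuousOn (uncurry h) (univ ×ˢ Ω)) {s : Set Y} (hs : IsOpen s) :
    IsOpen (Ω ∩ {x | ∀ k, h k x ∈ s}) := by
  refine isOpen_iff_mem_nhds.2 fun x hx => inter_mem (hΩ.mem_nhds hx.1) ?_
  have := isCompact_univ.eventually_forall_of_forall_eventually (x₀ := x) (K := (univ : Set K))
    (P := fun x k => h k x ∈ s) fun k _ => by
      have hat : ContinuousAt (uncurry h) (k, x) :=
        hc.continuousAt ((isOpen_univ.prod hΩ).mem_nhds ⟨trivial, hx.1⟩)
      have hat' : ContinuousAt (fun p : X × K => uncurry h (p.2, p.1)) (x, k) :=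
        ContinuousAt.comp (f := fun p : X × K => (p.2, p.1)) (g := uncurry h) hat (by fun_prop)
      exact hat'.preimage_mem_nhds (hs.mem_nhds (hx.2 k))
  filter_upwards [this] with y hy k using hy k trivial

/-! ### Haar averaging and Bochner's linearization. -/

section Haar

variable (G : Type*) [Group G] [TopologicalSpace G] [IsTopologicalGroup G] [CompactSpace G]
  [MeasurableSpace G] [BorelSpace G]

theorem exists_isProbabilityMeasure_isMulRightInvariant :
    ∃ ν : Measure G, IsProbabilityMeasure ν ∧ ν.IsMulRightInvariant := by
  let μ : Measure G := Measure.haarMeasure ⊤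
  have : IsProbabilityMeasure μ := ⟨Measure.haarMeasure_self (K₀ := ⊤)⟩
  refine ⟨μ.inv, ⟨?_⟩, inferInstance⟩
  rw [Measure.inv_apply, inv_univ]
  exact measure_univ

end Haar

namespace IsLocalAction

variable {G : Type*} [Group G] [TopologicalSpace G] [IsTopologicalGroup G] [CompactSpace G]
  {E : Type*} [NormedAddCommGroup E] [NormedSpace ℝ E] [FiniteDimensional ℝ E]
  {a : G → E → E} {Ω : Set E}

theorem continuous_fderiv_fixed (H : IsLocalAction a Ω) {y₀ : E} (hy₀ : y₀ ∈ Ω) :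
    Continuous fun g => fderiv ℝ (a g) y₀ :=
  continuous_slice H.continuousOn_fderiv hy₀

theorem contDiffOn_integral [MeasurableSpace G] [BorelSpace G] {ν : Measure G} [IsFiniteMeasure ν]
    {F F' : Type*} [NormedAddCommGroup F] [NormedSpace ℝ F] [NormedAddCommGroup F']
    [NormedSpace ℝ F'] [FiniteDimensional ℝ F'] (H : IsLocalAction a Ω) {f : E → F}
    (hf : ContDiffOn ℝ ∞ f Ω) {c : G → F →L[ℝ] F'} (hc : Continuous c) :
    ContDiffOn ℝ ∞ (fun x => ∫ g, c g (f (a g x)) ∂ν) Ω :=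
  contDiffOn_infty.2 fun n => (H.jointlyContDiffOn hf hc n).contDiffOn_integral H.isOpen

/-- Bochner's averaged linearizing map at a fixed point. -/
theorem exists_equivariant_map (H : IsLocalAction a Ω) {y₀ : E} (hy₀ : y₀ ∈ Ω)
    (hfix : ∀ g, a g y₀ = y₀) :
    ∃ ψ : E → E, ContDiffOn ℝ ∞ ψ Ω ∧ HasFDerivAt ψ (ContinuousLinearMap.id ℝ E) y₀ ∧
      ψ y₀ = 0 ∧ ∀ g, ∀ y ∈ Ω, ψ (a g y) = fderiv ℝ (a g) y₀ (ψ y) := by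
  borelize G
  obtain ⟨ν, hν, hν'⟩ := exists_isProbabilityMeasure_isMulRightInvariant G
  have hρ := H.continuous_fderiv_fixed hy₀
  have hc : Continuous fun g : G => fderiv ℝ (a g⁻¹) y₀ := hρ.comp continuous_inv
  have hf : ContDiffOn ℝ ∞ (fun y => y - y₀) Ω := by fun_prop
  have hcont := (H.jointlyContDiffOn hf hc 0).continuousOn
  have hD : ∀ g, ∀ x ∈ Ω, HasFDerivAt (fun y => fderiv ℝ (a g⁻¹) y₀ (a g y - y₀))
      ((fderiv ℝ (a g⁻¹) y₀).comp (fderiv ℝ (a g) x)) x := fun g x hx =>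
    (fderiv ℝ (a g⁻¹) y₀).hasFDerivAt.comp x ((H.hasFDerivAt g hx).sub_const y₀)
  -- Each integrand vanishes at `y₀` and has derivative `ρ(g⁻¹) ρ(g) = id` there, so the average has
  -- derivative `id` too.
  refine ⟨fun y => ∫ g, fderiv ℝ (a g⁻¹) y₀ (a g y - y₀) ∂ν, H.contDiffOn_integral hf hc, ?_,
    by simp [hfix], fun h y hy => ?_⟩
  · have key := hasFDerivAt_integral_of_continuousOn (μ := ν) H.isOpen hcont
      (fun g x hx => (hD g x hx).differentiableAt.differentiableWithinAt) ?_ hy₀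
    · convert key using 1
      have : ∀ g, fderiv ℝ (fun y => fderiv ℝ (a g⁻¹) y₀ (a g y - y₀)) y₀ =
          ContinuousLinearMap.id ℝ E := fun g => by
        rw [(hD g y₀ hy₀).fderiv, ← H.fderiv_mul_of_fixed hy₀ hfix, inv_mul_cancel,
          H.fderiv_one hy₀]
      simp only [this, integral_const, probReal_univ, one_smul]
    · refine ContinuousOn.congr (f := fun p : G × E =>
        (fderiv ℝ (a p.1⁻¹) y₀).comp (fderiv ℝ (a p.1) p.2)) ?_ fun p hp => (hD p.1 p.2 hp.2).fderiv
      exact ContinuousOn.clm_comp (hc.comp continuous_fst).continuousOn H.continuousOn_fderiv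
  · have hint : Integrable (fun g => fderiv ℝ (a g⁻¹) y₀ (a g y - y₀)) ν :=
      integrable_of_continuous_of_compactSpace (continuous_slice hcont hy)
    -- Substituting `g h` for `g` turns `ρ(h) ρ(g⁻¹)` into `ρ(h) ρ((g h)⁻¹) = ρ(g⁻¹)`.
    rw [← ContinuousLinearMap.integral_comp_comm _ hint,
      ← integral_mul_right_eq_self (μ := ν) (fun g => fderiv ℝ (a h) y₀ _) h]
    refine integral_congr_ae (Eventually.of_forall fun g => ?_)
    change fderiv ℝ (a g⁻¹) y₀ (a g (a h y) - y₀) =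
      fderiv ℝ (a h) y₀ (fderiv ℝ (a (g * h)⁻¹) y₀ (a (g * h) y - y₀))
    rw [← ContinuousLinearMap.comp_apply, ← H.fderiv_mul_of_fixed hy₀ hfix, H.mul g h y hy]
    simp

/-- **Bochner's linearization theorem**: near a fixed point a compact group of smooth maps is linear
in suitable coordinates. -/
theorem exists_linearization (H : IsLocalAction a Ω) {y₀ : E} (hy₀ : y₀ ∈ Ω)
    (hfix : ∀ g, a g y₀ = y₀) :
    ∃ ψ : OpenPartialHomeomorph E E, y₀ ∈ ψ.source ∧ ψ.source ⊆ Ω ∧ ψ y₀ = 0 ∧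
      ContDiffOn ℝ ∞ ψ ψ.source ∧ ContDiffOn ℝ ∞ ψ.symm ψ.target ∧
      ∀ g, ∀ y ∈ ψ.source, a g y ∈ ψ.source ∧ ψ (a g y) = fderiv ℝ (a g) y₀ (ψ y) := by
  obtain ⟨ψ, hψ, hψ', hψ0, heq⟩ := H.exists_equivariant_map hy₀ hfix
  have : CompleteSpace E := FiniteDimensional.complete ℝ E
  let e := (hψ.contDiffAt (H.isOpen.mem_nhds hy₀)).toOpenPartialHomeomorph ψ
    (f' := ContinuousLinearEquiv.refl ℝ E) hψ' (by simp)
  have he : ⇑e = ψ := rfl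
  have hye : y₀ ∈ e.source :=
    (hψ.contDiffAt (H.isOpen.mem_nhds hy₀)).mem_toOpenPartialHomeomorph_source _ _
  -- The derivative of `ψ` is invertible on `U`, which makes the inverse smooth on the whole target
  -- and not only at `ψ y₀`.
  let U : Set E := Ω ∩ fderiv ℝ ψ ⁻¹' range ((↑) : (E ≃L[ℝ] E) → E →L[ℝ] E)
  have hU : IsOpen U := (hψ.continuousOn_fderiv_of_isOpen H.isOpen (by simp)).isOpen_inter_preimage
    H.isOpen ContinuousLinearEquiv.isOpen
  have hyU : y₀ ∈ U := ⟨hy₀, ContinuousLinearEquiv.refl ℝ E, hψ'.fderiv.symm⟩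
  let s := e.source ∩ U
  have hs : IsOpen s := e.open_source.inter hU
  -- Shrinking to the points whose whole orbit stays in `s` makes the domain invariant.
  let S := Ω ∩ {y | ∀ g, a g y ∈ s}
  have hS : IsOpen S := isOpen_inter_setOf_forall_mem H.isOpen H.continuousOn hs
  have hSs : S ⊆ s := fun y hy => by simpa [H.one y hy.1] using hy.2 1
  have hsrc : (e.restrOpen S hS).source = S := by
    simpa using hSs.trans inter_subset_left
  refine ⟨e.restrOpen S hS, ?_, ?_, ?_, ?_, ?_, ?_⟩
  · rw [hsrc]
    exact ⟨hy₀, fun g => by rw [hfix]; exact ⟨hye, hyU⟩⟩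
  · rw [hsrc]
    exact inter_subset_left
  · exact hψ0
  · rw [hsrc]
    exact hψ.mono inter_subset_left
  · intro z hz
    refine ContDiffAt.contDiffWithinAt ?_
    have hz' : e.symm z ∈ S := by
      rw [← hsrc]
      exact (e.restrOpen S hS).map_target hz
    obtain ⟨f', hf'⟩ := (hSs hz').2.2
    refine (e.restrOpen S hS).contDiffAt_symm hz (f₀' := f') ?_
      (hψ.contDiffAt (H.isOpen.mem_nhds hz'.1))
    rw [hf']
    exact ((hψ.differentiableOn (by simp)).differentiableAt
      (H.isOpen.mem_nhds hz'.1)).hasFDerivAt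
  · intro g y hy
    rw [hsrc] at hy ⊢
    refine ⟨⟨H.mapsTo g hy.1, fun h => ?_⟩, heq g y hy.1⟩
    rw [← H.mul h g y hy.1]
    exact hy.2 _

end IsLocalAction

/-! ### Invariant chart domains and the submanifold structure of the fixed point set. -/

section InvariantCore

variable {M : Type*} {G : Type*} [Group G] [MulAction G M]

variable (G) in
/-- The largest `G`-invariant subset of `s`. -/
def invariantCore (s : Set M) : Set M := {x | ∀ g : G, g • x ∈ s}

theorem invariantCore_subset (s : Set M) : invariantCore G s ⊆ s := fun x hx => by
  simpa using hx 1

theorem smul_mem_invariantCore {s : Set M} {x : M} (hx : x ∈ invariantCore G s) (g : G) :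
    g • x ∈ invariantCore G s := fun h => by
  rw [smul_smul]
  exact hx _

theorem mem_invariantCore_of_fixed {s : Set M} {x : M} (hx : x ∈ s)
    (hfix : x ∈ MulAction.fixedPoints G M) : x ∈ invariantCore G s := fun g => by
  rwa [hfix g]

theorem isOpen_invariantCore [TopologicalSpace M] [TopologicalSpace G] [CompactSpace G]
    [ContinuousSMul G M] {s : Set M} (hs : IsOpen s) : IsOpen (invariantCore G s) := by
  have := isOpen_inter_setOf_forall_mem (h := fun (g : G) (x : M) => g • x) isOpen_univ
    (continuous_smul (M := G) (X := M)).continuousOn hs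
  rwa [univ_inter] at this

end InvariantCore

section ManifoldAction

variable {E : Type*} [NormedAddCommGroup E] [NormedSpace ℝ E]
  {M : Type*} [TopologicalSpace M] [ChartedSpace E M]
  {G : Type*} [Group G] [TopologicalSpace G] [CompactSpace G]
  [MulAction G M] [ContinuousSMul G M]

/-- The expression of the action in a chart. -/
theorem isLocalAction_chart [IsManifold 𝓘(ℝ, E) ∞ M]
    (hsmooth : ∀ g : G, ContMDiff 𝓘(ℝ, E) 𝓘(ℝ, E) ∞ fun x : M => g • x)
    {e : OpenPartialHomeomorph M E} (he : e ∈ IsManifold.maximalAtlas 𝓘(ℝ, E) ∞ M) :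
    IsLocalAction (fun (g : G) y => e (g • e.symm y))
      (e.target ∩ e.symm ⁻¹' invariantCore G e.source) where
  isOpen := e.isOpen_inter_preimage_symm (isOpen_invariantCore e.open_source)
  mapsTo g y hy := by
    have h := smul_mem_invariantCore hy.2 g
    have h' := invariantCore_subset _ h
    refine ⟨e.map_source h', ?_⟩
    rwa [mem_preimage, e.left_inv h']
  one y hy := by simp [e.right_inv hy.1]
  mul g h y hy := by
    rw [e.left_inv (hy.2 h), mul_smul]
  continuousOn := by
    refine e.continuousOn.comp (f := fun p : G × E => p.1 • e.symm p.2) ?_ fun p hp => hp.2.2 p.1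
    exact continuousOn_fst.smul (e.continuousOn_symm.comp continuousOn_snd fun p hp => hp.2.1)
  contDiffOn g := by
    rw [← contMDiffOn_iff_contDiffOn]
    refine (contMDiffOn_of_mem_maximalAtlas he).comp (t := e.source) ?_ fun y hy => hy.2 g
    exact (hsmooth g).comp_contMDiffOn
      ((contMDiffOn_symm_of_mem_maximalAtlas he).mono inter_subset_left)

/-- Around a fixed point there is a chart with `G`-invariant domain in which `G` acts linearly. -/
theorem exists_linearizing_chart [IsTopologicalGroup G] [FiniteDimensional ℝ E]
    [IsManifold 𝓘(ℝ, E) ∞ M]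
    (hsmooth : ∀ g : G, ContMDiff 𝓘(ℝ, E) 𝓘(ℝ, E) ∞ fun x : M => g • x)
    {x₀ : M} (hx₀ : x₀ ∈ MulAction.fixedPoints G M) :
    ∃ φ ∈ IsManifold.maximalAtlas 𝓘(ℝ, E) ∞ M, x₀ ∈ φ.source ∧ φ x₀ = 0 ∧
      ∃ ρ : G → E →L[ℝ] E, Continuous ρ ∧ (∀ g h, ρ (g * h) = (ρ g).comp (ρ h)) ∧
        ∀ g, ∀ x ∈ φ.source, g • x ∈ φ.source ∧ φ (g • x) = ρ g (φ x) := by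
  set e := chartAt E x₀ with he_def
  have he : e ∈ IsManifold.maximalAtlas 𝓘(ℝ, E) ∞ M := IsManifold.chart_mem_maximalAtlas x₀
  have hxe : x₀ ∈ e.source := mem_chart_source E x₀
  have H := isLocalAction_chart hsmooth he
  have hy₀ : e x₀ ∈ e.target ∩ e.symm ⁻¹' invariantCore G e.source :=
    ⟨e.map_source hxe, by
      rw [mem_preimage, e.left_inv hxe]; exact mem_invariantCore_of_fixed hxe hx₀⟩
  have hfix : ∀ g : G, e (g • e.symm (e x₀)) = e x₀ := fun g => by
    rw [e.left_inv hxe, hx₀ g]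
  obtain ⟨ψ, hyψ, hψΩ, hψ0, hψ, hψs, heq⟩ := H.exists_linearization hy₀ hfix
  have hsrc : (e ≫ₕ ψ).source = e.source ∩ e ⁻¹' ψ.source := by simp
  refine ⟨e ≫ₕ ψ, ?_, ⟨hxe, hyψ⟩, hψ0, _, H.continuous_fderiv_fixed hy₀,
    H.fderiv_mul_of_fixed hy₀ hfix, fun g x hx => ?_⟩
  · refine OpenPartialHomeomorph.mem_maximalAtlas_of_contMDiffOn _ ?_ ?_
    · exact hψ.contMDiffOn.comp ((contMDiffOn_of_mem_maximalAtlas he).mono fun x hx => hx.1)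
        fun x hx => hx.2
    · exact (contMDiffOn_symm_of_mem_maximalAtlas he).comp
        (hψs.contMDiffOn.mono fun x hx => hx.1) fun x hx => hx.2
  · rw [hsrc] at hx ⊢
    obtain ⟨h1, h2⟩ := heq g (e x) hx.2
    have h3 := (hψΩ hx.2).2
    rw [mem_preimage, e.left_inv hx.1] at h3
    rw [e.left_inv hx.1] at h1 h2
    exact ⟨⟨h3 g, h1⟩, h2⟩

theorem isEmbeddedSubmanifold_fixedPoints [IsTopologicalGroup G] [FiniteDimensional ℝ E]
    [IsManifold 𝓘(ℝ, E) ∞ M]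
    (hsmooth : ∀ g : G, ContMDiff 𝓘(ℝ, E) 𝓘(ℝ, E) ∞ fun x : M => g • x) :
    IsEmbeddedSubmanifold E (MulAction.fixedPoints G M) := by
  intro x hx
  obtain ⟨φ, hφ, hxφ, -, ρ, -, -, h⟩ := exists_linearizing_chart hsmooth hx
  -- The subspace consists of the vectors fixed by every `ρ g`; equivariance and injectivity of `φ`
  -- identify it with the fixed points in the chart.
  refine ⟨φ, hφ, hxφ, ⨅ g, LinearMap.eqLocus (ρ g : E →ₗ[ℝ] E) LinearMap.id, fun y hy => ?_⟩
  simp only [Submodule.mem_iInf, LinearMap.mem_eqLocus]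
  refine forall_congr' fun g => ?_
  change g • y = y ↔ ρ g (φ y) = φ y
  rw [← (h g y hy).2, φ.injOn.eq_iff (h g y hy).1 hy]

end ManifoldAction

/-! ### Derivations at a point see only the differential. -/

section PointDerivation

variable {E : Type*} [NormedAddCommGroup E] [NormedSpace ℝ E]
  {M : Type*} [TopologicalSpace M] [ChartedSpace E M]

theorem contDiffOn_comp_chart_symm {φ : OpenPartialHomeomorph M E}
    (hφ : φ ∈ IsManifold.maximalAtlas 𝓘(ℝ, E) ∞ M) (F : C^∞⟮𝓘(ℝ, E), M; ℝ⟯) :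
    ContDiffOn ℝ ∞ (F ∘ φ.symm) φ.target := by
  rw [← contMDiffOn_iff_contDiffOn]
  exact F.contMDiff.comp_contMDiffOn (contMDiffOn_symm_of_mem_maximalAtlas hφ)

/-- A derivation of `C^∞(M)` at the point `x₀`. -/
structure IsDerivationAt (x₀ : M) (D : C^∞⟮𝓘(ℝ, E), M; ℝ⟯ →ₗ[ℝ] ℝ) : Prop where
  leibniz : ∀ F K, D (F * K) = D F * K x₀ + F x₀ * D K

namespace IsDerivationAt

variable {x₀ : M} {D : C^∞⟮𝓘(ℝ, E), M; ℝ⟯ →ₗ[ℝ] ℝ}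

theorem apply_one (hD : IsDerivationAt x₀ D) : D 1 = 0 := by
  have := hD.leibniz 1 1
  simp only [mul_one, ContMDiffMap.coe_one, Pi.one_apply, one_mul] at this
  linarith

theorem apply_mul_eq_zero (hD : IsDerivationAt x₀ D) {F K : C^∞⟮𝓘(ℝ, E), M; ℝ⟯}
    (hF : F x₀ = 0) (hK : K x₀ = 0) : D (F * K) = 0 := by
  rw [hD.leibniz, hF, hK]
  ring

end IsDerivationAt

end PointDerivation

section SmoothExtension

variable {E : Type*} [NormedAddCommGroup E] [NormedSpace ℝ E] [FiniteDimensional ℝ E]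
  {M : Type*} [TopologicalSpace M] [T2Space M] [ChartedSpace E M] [IsManifold 𝓘(ℝ, E) ∞ M]

theorem exists_smooth_extension {U : Set M} (hU : IsOpen U) {F₀ : M → ℝ}
    (hF₀ : ContMDiffOn 𝓘(ℝ, E) 𝓘(ℝ, ℝ) ∞ F₀ U) {x₀ : M} (hx₀ : x₀ ∈ U) :
    ∃ F : C^∞⟮𝓘(ℝ, E), M; ℝ⟯, HasCompactSupport F ∧ tsupport F ⊆ U ∧ F =ᶠ[𝓝 x₀] F₀ := by
  obtain ⟨b, hb, -⟩ := (SmoothBumpFunction.nhds_basis_support (I := 𝓘(ℝ, E))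
    (hU.mem_nhds hx₀)).mem_iff.1 (hU.mem_nhds hx₀)
  have hts : tsupport (fun x => b x • F₀ x) ⊆ tsupport b := tsupport_smul_subset_left _ _
  refine ⟨⟨fun x => b x • F₀ x, contMDiff_of_tsupport fun x hx => ?_⟩, ?_, hts.trans hb, ?_⟩
  · exact b.contMDiffAt.smul (hF₀.contMDiffAt (hU.mem_nhds (hb (hts hx))))
  · exact b.hasCompactSupport.mono' (subset_closure.trans hts)
  · filter_upwards [b.eventuallyEq_one] with x hx
    change b x • F₀ x = F₀ x
    rw [hx]
    simp

namespace IsDerivationAt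

variable {x₀ : M} {D : C^∞⟮𝓘(ℝ, E), M; ℝ⟯ →ₗ[ℝ] ℝ}

/-- A bump function `b` with `b x₀ = 1`, supported where `F` vanishes, gives `b * F = 0`; the
Leibniz rule at `x₀` then reads `0 = D F`. -/
theorem apply_eq_zero_of_eventuallyEq (hD : IsDerivationAt x₀ D) {F : C^∞⟮𝓘(ℝ, E), M; ℝ⟯}
    (hF : F =ᶠ[𝓝 x₀] 0) : D F = 0 := by
  obtain ⟨U, hUF, hU, hxU⟩ := mem_nhds_iff.1 hF
  obtain ⟨b, -, hb, hb1⟩ := exists_smooth_extension hU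
    (contMDiffOn_const (c := (1 : ℝ)) (I := 𝓘(ℝ, E))) hxU
  have hbF : b * F = 0 := by
    ext x
    by_cases hx : x ∈ U
    · have : F x = 0 := hUF hx
      simp [this]
    · have : b x = 0 := image_eq_zero_of_notMem_tsupport fun h => hx (hb h)
      simp [this]
  have h := hD.leibniz b F
  have h1 : b x₀ = 1 := hb1.eq_of_nhds
  have h2 : F x₀ = 0 := hF.eq_of_nhds
  rw [hbF, map_zero, h1, h2] at h
  linarith

theorem apply_congr (hD : IsDerivationAt x₀ D) {F K : C^∞⟮𝓘(ℝ, E), M; ℝ⟯}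
    (hF : F =ᶠ[𝓝 x₀] K) : D F = D K := by
  rw [← sub_eq_zero, ← map_sub]
  refine hD.apply_eq_zero_of_eventuallyEq ?_
  filter_upwards [hF] with x hx
  simp [hx]

end IsDerivationAt

end SmoothExtension

section Hadamard

variable {E : Type*} [NormedAddCommGroup E] [NormedSpace ℝ E] [FiniteDimensional ℝ E]

/-- **Hadamard's lemma** on a ball. -/
theorem exists_hadamard_factor {f : E → ℝ} {r : ℝ} (hf : ContDiffOn ℝ ∞ f (Metric.ball 0 r)) :
    ∃ g : E → E →L[ℝ] ℝ, ContDiffOn ℝ ∞ g (Metric.ball 0 r) ∧ g 0 = fderiv ℝ f 0 ∧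
      ∀ y ∈ Metric.ball (0 : E) r, f y = f 0 + g y y := by
  have hf' : ContDiffOn ℝ ∞ (fderiv ℝ f) (Metric.ball 0 r) :=
    hf.fderiv_of_isOpen Metric.isOpen_ball (by simp)
  have hm : ∀ t : unitInterval, MapsTo ((t : ℝ) • ContinuousLinearMap.id ℝ E)
      (Metric.ball 0 r) (Metric.ball 0 r) := by
    intro t y hy
    simp only [mem_ball_zero_iff, smul_apply, ContinuousLinearMap.id_apply,
      norm_smul, Real.norm_of_nonneg t.2.1] at hy ⊢
    exact (mul_le_of_le_one_left (norm_nonneg y) t.2.2).trans_lt hy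
  have hJ := jointlyContDiffOn_comp_clm Metric.isOpen_ball hf'
    (T := fun t : unitInterval => (t : ℝ) • ContinuousLinearMap.id ℝ E) (by fun_prop)
    Metric.isOpen_ball hm
  -- The factor is `∫₀¹ df(t y) dt`, from the fundamental theorem of calculus along `t ↦ t y`.
  refine ⟨fun y => ∫ t : unitInterval, fderiv ℝ f (((t : ℝ) • ContinuousLinearMap.id ℝ E) y),
    contDiffOn_infty.2 fun n => (hJ n).contDiffOn_integral Metric.isOpen_ball, by simp,
    fun y hy => ?_⟩
  have hint := integrable_of_continuous_of_compactSpace (μ := (volume : Measure unitInterval))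
    (continuous_slice (hJ 0).continuousOn hy)
  rw [ContinuousLinearMap.integral_apply hint]
  have hmem : ∀ t ∈ Icc (0 : ℝ) 1, t • y ∈ Metric.ball (0 : E) r := fun t ht => hm ⟨t, ht⟩ hy
  have h1 : (∫ t : unitInterval, fderiv ℝ f (((t : ℝ) • ContinuousLinearMap.id ℝ E) y) y) =
      ∫ t in (0 : ℝ)..1, fderiv ℝ f (t • y) y := by
    rw [intervalIntegral.integral_of_le zero_le_one, ← integral_Icc_eq_integral_Ioc]
    exact integral_subtype measurableSet_Icc fun t : ℝ => fderiv ℝ f (t • y) y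
  rw [h1, intervalIntegral.integral_eq_sub_of_hasDerivAt (f := fun t : ℝ => f (t • y))]
  · simp
  · intro t ht
    rw [uIcc_of_le zero_le_one] at ht
    have hd : HasFDerivAt f (fderiv ℝ f (t • y)) (t • y) :=
      ((hf.differentiableOn (by simp)).differentiableAt
        (Metric.isOpen_ball.mem_nhds (hmem t ht))).hasFDerivAt
    simpa [comp_def] using hd.comp_hasDerivAt t ((hasDerivAt_id t).smul_const y)
  · refine ContinuousOn.intervalIntegrable ?_
    rw [uIcc_of_le zero_le_one]
    exact (hf'.continuousOn.comp (f := fun t : ℝ => t • y) (by fun_prop) hmem).clm_apply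
      continuousOn_const

variable {M : Type*} [TopologicalSpace M] [T2Space M] [ChartedSpace E M]
  [IsManifold 𝓘(ℝ, E) ∞ M] {x₀ : M} {D : C^∞⟮𝓘(ℝ, E), M; ℝ⟯ →ₗ[ℝ] ℝ}

/-- A derivation at a point vanishes on functions with vanishing differential. -/
theorem IsDerivationAt.apply_eq_zero_of_fderiv_eq_zero (hD : IsDerivationAt x₀ D)
    {φ : OpenPartialHomeomorph M E} (hφ : φ ∈ IsManifold.maximalAtlas 𝓘(ℝ, E) ∞ M)
    (hx₀ : x₀ ∈ φ.source) (hφ0 : φ x₀ = 0) {F : C^∞⟮𝓘(ℝ, E), M; ℝ⟯}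
    (hF : fderiv ℝ (F ∘ φ.symm) 0 = 0) : D F = 0 := by
  obtain ⟨r, hr, hball⟩ := Metric.isOpen_iff.1 φ.open_target 0 (hφ0 ▸ φ.map_source hx₀)
  obtain ⟨g, hg, hg0, hfg⟩ := exists_hadamard_factor ((contDiffOn_comp_chart_symm hφ F).mono hball)
  let U : Set M := φ.source ∩ φ ⁻¹' Metric.ball 0 r
  have hU : IsOpen U := φ.isOpen_inter_preimage Metric.isOpen_ball
  have hxU : x₀ ∈ U := ⟨hx₀, by simp [hφ0, hr]⟩
  have hφU : ContMDiffOn 𝓘(ℝ, E) 𝓘(ℝ, E) ∞ φ U :=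
    (contMDiffOn_of_mem_maximalAtlas hφ).mono inter_subset_left
  let β := Module.finBasis ℝ E
  have hX : ∀ i, ∃ X : C^∞⟮𝓘(ℝ, E), M; ℝ⟯, X =ᶠ[𝓝 x₀] fun x => β.coord i (φ x) := fun i => by
    obtain ⟨X, -, -, hX⟩ := exists_smooth_extension hU
      ((β.coord i).toContinuousLinearMap.contMDiff.comp_contMDiffOn hφU) hxU
    exact ⟨X, hX⟩
  have hY : ∀ i, ∃ Y : C^∞⟮𝓘(ℝ, E), M; ℝ⟯, Y =ᶠ[𝓝 x₀] fun x => g (φ x) (β i) := fun i => by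
    have hgi : ContDiffOn ℝ ∞ (fun y => g y (β i)) (Metric.ball 0 r) :=
      hg.clm_apply contDiffOn_const
    obtain ⟨Y, -, -, hY⟩ := exists_smooth_extension hU
      (hgi.contMDiffOn.comp hφU fun x hx => hx.2) hxU
    exact ⟨Y, hY⟩
  choose X hX using hX
  choose Y hY using hY
  -- Here `X i` is a coordinate, vanishing at `x₀`, and `Y i` is a Hadamard factor whose value at
  -- `x₀` is a partial derivative of `F`, hence zero. So each product is killed by `D`.
  have hFeq : F =ᶠ[𝓝 x₀] (F x₀ • (1 : C^∞⟮𝓘(ℝ, E), M; ℝ⟯) + ∑ i, X i * Y i :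
      C^∞⟮𝓘(ℝ, E), M; ℝ⟯) := by
    filter_upwards [eventually_all.2 hX, eventually_all.2 hY, hU.mem_nhds hxU] with x h1 h2 h3
    have h4 := hfg (φ x) h3.2
    have h5 : φ.symm 0 = x₀ := by rw [← hφ0, φ.left_inv hx₀]
    simp only [comp_apply, φ.left_inv h3.1, h5] at h4
    have h6 : g (φ x) (φ x) = ∑ i, β.coord i (φ x) * g (φ x) (β i) := by
      have key : ∀ (L : E →L[ℝ] ℝ) (z : E), L z = ∑ i, β.coord i z * L (β i) := fun L z => by
        conv_lhs => rw [← β.sum_repr z, map_sum]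
        simp
      exact key _ _
    have h7 : (∑ i, X i * Y i : C^∞⟮𝓘(ℝ, E), M; ℝ⟯) x = ∑ i, X i x * Y i x := by
      rw [← ContMDiffMap.coeFnRingHom_apply, map_sum, Finset.sum_apply]
      rfl
    rw [h4, h6, ContMDiffMap.coe_add, Pi.add_apply, h7]
    simp [h1, h2]
  rw [hD.apply_congr hFeq, map_add, map_smul, hD.apply_one, map_sum, Finset.sum_eq_zero, smul_zero,
    add_zero]
  intro i _
  refine hD.apply_mul_eq_zero ?_ ?_
  · rw [(hX i).eq_of_nhds, hφ0, map_zero]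
  · rw [(hY i).eq_of_nhds, hφ0, hg0, hF]
    rfl

end Hadamard

/-! ### Invariant extensions and their differentials. -/

section InvariantFunctions

variable {E : Type*} [NormedAddCommGroup E] [NormedSpace ℝ E] [FiniteDimensional ℝ E]
  {M : Type*} [TopologicalSpace M] [T2Space M] [ChartedSpace E M] [IsManifold 𝓘(ℝ, E) ∞ M]
  {G : Type*} [Group G] [TopologicalSpace G] [IsTopologicalGroup G] [CompactSpace G]
  [MulAction G M] [ContinuousSMul G M]

/-- Averaging a function which is compactly supported in an invariant chart domain. -/
theorem contMDiff_average [MeasurableSpace G] [BorelSpace G] {ν : Measure G} [IsFiniteMeasure ν]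
    (hsmooth : ∀ g : G, ContMDiff 𝓘(ℝ, E) 𝓘(ℝ, E) ∞ fun x : M => g • x)
    {e : OpenPartialHomeomorph M E} (he : e ∈ IsManifold.maximalAtlas 𝓘(ℝ, E) ∞ M)
    (F : C^∞⟮𝓘(ℝ, E), M; ℝ⟯) (hF : HasCompactSupport F)
    (hFe : tsupport F ⊆ invariantCore G e.source) :
    ContMDiff 𝓘(ℝ, E) 𝓘(ℝ, ℝ) ∞ fun x => ∫ g : G, F (g • x) ∂ν := by
  have H := isLocalAction_chart hsmooth he
  have hcore : IsOpen (invariantCore G e.source) := isOpen_invariantCore e.open_source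
  have hf : ContDiffOn ℝ ∞ (F ∘ e.symm) (e.target ∩ e.symm ⁻¹' invariantCore G e.source) :=
    (contDiffOn_comp_chart_symm he F).mono inter_subset_left
  have hA := H.contDiffOn_integral (ν := ν) hf
    (c := fun _ => ContinuousLinearMap.id ℝ ℝ) continuous_const
  have hon : ContMDiffOn 𝓘(ℝ, E) 𝓘(ℝ, ℝ) ∞ (fun x => ∫ g : G, F (g • x) ∂ν)
      (invariantCore G e.source) := by
    refine (hA.contMDiffOn.comp ((contMDiffOn_of_mem_maximalAtlas he).mono
      (invariantCore_subset _)) fun x hx => ?_).congr fun x hx => ?_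
    · have hxe := invariantCore_subset _ hx
      exact ⟨e.map_source hxe, by rwa [mem_preimage, e.left_inv hxe]⟩
    · simp [e.left_inv (invariantCore_subset _ hx), e.left_inv (hx _)]
  -- The average is supported in the orbit of the support of `F`, which is compact and lies in the
  -- invariant chart domain, so smoothness has to be checked only there.
  let T : Set M := (fun p : G × M => p.1 • p.2) '' (univ ×ˢ tsupport F)
  have hT : IsClosed T := ((isCompact_univ.prod hF).image continuous_smul).isClosed
  have hTcore : T ⊆ invariantCore G e.source := by
    rintro _ ⟨⟨g, x⟩, ⟨-, hx⟩, rfl⟩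
    exact smul_mem_invariantCore (hFe hx) g
  refine contMDiff_of_tsupport fun x hx => hon.contMDiffAt (hcore.mem_nhds (hTcore ?_))
  refine closure_minimal (fun y hy => ?_) hT hx
  by_contra hyT
  refine hy ?_
  have : ∀ g : G, F (g • y) = 0 := fun g => image_eq_zero_of_notMem_tsupport fun h =>
    hyT ⟨(g⁻¹, g • y), ⟨trivial, h⟩, inv_smul_smul g y⟩
  simp [this]

/-- A local extension is cut off inside an invariant chart domain and averaged. Averaging with total
mass one does not change values at fixed points, so the result still extends `f` near `x₀`. -/
theorem exists_invariant_extension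
    (hsmooth : ∀ g : G, ContMDiff 𝓘(ℝ, E) 𝓘(ℝ, E) ∞ fun x : M => g • x)
    (f : smoothFunctions E (MulAction.fixedPoints G M)) {x₀ : M}
    (hx₀ : x₀ ∈ MulAction.fixedPoints G M) :
    ∃ F : C^∞⟮𝓘(ℝ, E), M; ℝ⟯, (∀ (g : G) (x : M), F (g • x) = F x) ∧
      ∀ᶠ x in 𝓝 x₀, ∀ hx : x ∈ MulAction.fixedPoints G M, F x = f.1 ⟨x, hx⟩ := by
  borelize G
  obtain ⟨ν, hν, hν'⟩ := exists_isProbabilityMeasure_isMulRightInvariant G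
  obtain ⟨U, hU, hxU, F₀, hF₀, hfF₀⟩ := f.2 ⟨x₀, hx₀⟩
  have he : chartAt E x₀ ∈ IsManifold.maximalAtlas 𝓘(ℝ, E) ∞ M :=
    IsManifold.chart_mem_maximalAtlas x₀
  have hcore : IsOpen (invariantCore G (chartAt E x₀).source) :=
    isOpen_invariantCore (chartAt E x₀).open_source
  obtain ⟨F, hFc, hFs, hFF₀⟩ := exists_smooth_extension (hU.inter hcore)
    (hF₀.mono inter_subset_left)
    ⟨hxU, mem_invariantCore_of_fixed (mem_chart_source E x₀) hx₀⟩
  refine ⟨⟨_, contMDiff_average (ν := ν) hsmooth he F hFc (hFs.trans inter_subset_right)⟩,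
    fun h x => ?_, ?_⟩
  · change ∫ g : G, F (g • h • x) ∂ν = ∫ g : G, F (g • x) ∂ν
    rw [← integral_mul_right_eq_self (μ := ν) (fun g => F (g • x)) h]
    simp only [mul_smul]
  · filter_upwards [hFF₀, hU.mem_nhds hxU] with x hx hxU' hxN
    change ∫ g : G, F (g • x) ∂ν = _
    have : ∀ g : G, F (g • x) = F x := fun g => by rw [hxN g]
    simp only [this, integral_const, probReal_univ, one_smul]
    rw [hx]
    exact hfF₀ ⟨x, hxN⟩ hxU'

/-- An invariant function vanishing on the fixed points near `x₀` has zero differential at `x₀`. -/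
theorem IsDerivationAt.apply_eq_zero_of_invariant
    (hsmooth : ∀ g : G, ContMDiff 𝓘(ℝ, E) 𝓘(ℝ, E) ∞ fun x : M => g • x) {x₀ : M}
    (hx₀ : x₀ ∈ MulAction.fixedPoints G M) {D : C^∞⟮𝓘(ℝ, E), M; ℝ⟯ →ₗ[ℝ] ℝ}
    (hD : IsDerivationAt x₀ D) {F : C^∞⟮𝓘(ℝ, E), M; ℝ⟯}
    (hinv : ∀ (g : G) (x : M), F (g • x) = F x)
    (hF : ∀ᶠ x in 𝓝 x₀, x ∈ MulAction.fixedPoints G M → F x = 0) : D F = 0 := by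
  borelize G
  obtain ⟨ν, hν, hν'⟩ := exists_isProbabilityMeasure_isMulRightInvariant G
  obtain ⟨φ, hφ, hxφ, hφ0, ρ, hρ, hρmul, h⟩ := exists_linearizing_chart hsmooth hx₀
  refine hD.apply_eq_zero_of_fderiv_eq_zero hφ hxφ hφ0 ?_
  have h0 : (0 : E) ∈ φ.target := hφ0 ▸ φ.map_source hxφ
  have h0s : φ.symm 0 = x₀ := by rw [← hφ0, φ.left_inv hxφ]
  have hsymm : ∀ g, ∀ y ∈ φ.target, φ.symm (ρ g y) = g • φ.symm y := fun g y hy => by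
    obtain ⟨h1, h2⟩ := h g _ (φ.map_target hy)
    rw [φ.right_inv hy] at h2
    rw [← h2, φ.left_inv h1]
  have hd : HasFDerivAt (F ∘ φ.symm) (fderiv ℝ (F ∘ φ.symm) 0) 0 :=
    (((contDiffOn_comp_chart_symm hφ F).differentiableOn (by simp)).differentiableAt
      (φ.open_target.mem_nhds h0)).hasFDerivAt
  set L := fderiv ℝ (F ∘ φ.symm) 0 with hL
  have hLρ : ∀ g v, L (ρ g v) = L v := fun g v => by
    have heq : (F ∘ φ.symm) ∘ ρ g =ᶠ[𝓝 0] F ∘ φ.symm := by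
      filter_upwards [φ.open_target.mem_nhds h0] with y hy
      simp [hsymm g y hy, hinv]
    have hd' : HasFDerivAt ((F ∘ φ.symm) ∘ ρ g) (L.comp (ρ g)) 0 :=
      HasFDerivAt.comp 0 (by rwa [map_zero]) (ρ g).hasFDerivAt
    exact congrArg (fun A : E →L[ℝ] ℝ => A v) ((hd'.congr_of_eventuallyEq heq.symm).unique hd)
  -- For small `t` the chart sends `t • w` to a fixed point of `G`, where `F` vanishes;
  -- differentiating along this line gives `L w = 0`.
  have hLfix : ∀ w, (∀ g, ρ g w = w) → L w = 0 := fun w hw => by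
    have hcurve : HasDerivAt (fun t : ℝ => t • w) w 0 := by
      simpa using (hasDerivAt_id (0 : ℝ)).smul_const w
    have hd' : HasDerivAt ((F ∘ φ.symm) ∘ fun t : ℝ => t • w) (L w) 0 :=
      HasFDerivAt.comp_hasDerivAt 0 (by rwa [zero_smul]) hcurve
    refine hd'.unique ((hasDerivAt_const (0 : ℝ) (0 : ℝ)).congr_of_eventuallyEq ?_)
    have ht : Tendsto (fun t : ℝ => t • w) (𝓝 0) (𝓝 0) := by
      simpa using hcurve.continuousAt.tendsto
    have hs : Tendsto φ.symm (𝓝 0) (𝓝 x₀) := by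
      simpa [h0s] using (φ.continuousAt_symm h0).tendsto
    filter_upwards [ht.eventually (φ.open_target.mem_nhds h0), (hs.comp ht).eventually hF]
      with t h1 h2
    refine h2 fun g => ?_
    change g • φ.symm (t • w) = φ.symm (t • w)
    rw [← hsymm g _ h1, map_smul, hw]
  ext v
  have hcont : Continuous fun g : G => ρ g⁻¹ v := by fun_prop
  have hint : Integrable (fun g : G => ρ g⁻¹ v) ν := integrable_of_continuous_of_compactSpace hcont
  -- The average of the orbit of `v` is a fixed vector, and by invariance `L` takes the same value
  -- on it as on `v`.
  have hw : ∀ k, ρ k (∫ g : G, ρ g⁻¹ v ∂ν) = ∫ g : G, ρ g⁻¹ v ∂ν := fun k => by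
    rw [← ContinuousLinearMap.integral_comp_comm _ hint,
      ← integral_mul_right_eq_self (μ := ν) (fun g => ρ k (ρ g⁻¹ v)) k]
    refine integral_congr_ae (Eventually.of_forall fun g => ?_)
    change ρ k (ρ (g * k)⁻¹ v) = ρ g⁻¹ v
    rw [← ContinuousLinearMap.comp_apply, ← hρmul]
    simp
  have := hLfix _ hw
  rw [← ContinuousLinearMap.integral_comp_comm _ hint] at this
  simpa [hLρ] using this

end InvariantFunctions

/-! ### Locality of brackets and germs of invariant extensions. -/

section Locality

variable {E : Type*} [NormedAddCommGroup E] [NormedSpace ℝ E] {M : Type*} [TopologicalSpace M]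
  [ChartedSpace E M]

/-- The Hamiltonian derivation `K ↦ {F, K}(x₀)`. -/
noncomputable def hamiltonianAt (P : PoissonStructure C^∞⟮𝓘(ℝ, E), M; ℝ⟯) (x₀ : M)
    (F : C^∞⟮𝓘(ℝ, E), M; ℝ⟯) : C^∞⟮𝓘(ℝ, E), M; ℝ⟯ →ₗ[ℝ] ℝ where
  toFun K := P.bracket F K x₀
  map_add' K L := by simp
  map_smul' c K := by simp

theorem isDerivationAt_hamiltonianAt (P : PoissonStructure C^∞⟮𝓘(ℝ, E), M; ℝ⟯) (x₀ : M)
    (F : C^∞⟮𝓘(ℝ, E), M; ℝ⟯) : IsDerivationAt x₀ (hamiltonianAt P x₀ F) where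
  leibniz K L := by simp [hamiltonianAt, P.leibniz]

/-- Brackets on `C^∞(N)` are local. -/
theorem PoissonStructure.bracket_apply_eq_zero [FiniteDimensional ℝ E] [T2Space M]
    [IsManifold 𝓘(ℝ, E) ∞ M] {N : Set M} (Q : PoissonStructure (smoothFunctions E N))
    (h k : smoothFunctions E N) (x : N) (hk : ∀ᶠ y in 𝓝 (x : M), ∀ hy : y ∈ N, k.1 ⟨y, hy⟩ = 0) :
    (Q.bracket h k).1 x = 0 := by
  obtain ⟨U, hUk, hU, hxU⟩ := mem_nhds_iff.1 hk
  obtain ⟨b, -, hb, hb1⟩ := exists_smooth_extension hU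
    (contMDiffOn_const (c := (1 : ℝ)) (I := 𝓘(ℝ, E))) hxU
  -- Since `b` is supported where `k` vanishes on `N`, expanding `{h, b k} = 0` at `x` leaves only
  -- `b(x) {h, k}(x)`.
  have hbk : restrict N b * k = 0 := by
    ext y
    change b y * k.1 y = 0
    by_cases hy : (y : M) ∈ U
    · rw [hUk hy y.2, mul_zero]
    · rw [image_eq_zero_of_notMem_tsupport fun h => hy (hb h), zero_mul]
  have hl := congrArg (fun f : smoothFunctions E N => f.1 x) (Q.leibniz h (restrict N b) k)
  rw [hbk, map_zero] at hl
  change 0 = (Q.bracket h (restrict N b)).1 x * k.1 x + b x * (Q.bracket h k).1 x at hl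
  rw [hUk hxU x.2, hb1.eq_of_nhds] at hl
  linarith

theorem PoissonStructure.bracket_apply_congr [FiniteDimensional ℝ E] [T2Space M]
    [IsManifold 𝓘(ℝ, E) ∞ M] {N : Set M} (Q : PoissonStructure (smoothFunctions E N))
    {f₁ f₂ k₁ k₂ : smoothFunctions E N} (x : N)
    (h₁ : ∀ᶠ y in 𝓝 (x : M), ∀ hy : y ∈ N, f₁.1 ⟨y, hy⟩ = k₁.1 ⟨y, hy⟩)
    (h₂ : ∀ᶠ y in 𝓝 (x : M), ∀ hy : y ∈ N, f₂.1 ⟨y, hy⟩ = k₂.1 ⟨y, hy⟩) :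
    (Q.bracket f₁ f₂).1 x = (Q.bracket k₁ k₂).1 x := by
  have e1 : (Q.bracket f₂ (f₁ - k₁)).1 x = 0 := Q.bracket_apply_eq_zero _ _ x <| by
    filter_upwards [h₁] with y hy hyN
    exact sub_eq_zero.2 (hy hyN)
  have e2 : (Q.bracket k₁ (f₂ - k₂)).1 x = 0 := Q.bracket_apply_eq_zero _ _ x <| by
    filter_upwards [h₂] with y hy hyN
    exact sub_eq_zero.2 (hy hyN)
  rw [map_sub] at e1 e2
  rw [Q.skew f₂ f₁, Q.skew f₂ k₁] at e1
  change -(Q.bracket f₁ f₂).1 x - -(Q.bracket k₁ f₂).1 x = 0 at e1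
  change (Q.bracket k₁ f₂).1 x - (Q.bracket k₁ k₂).1 x = 0 at e2
  linarith

end Locality

section InvariantExtension

variable {E : Type*} [NormedAddCommGroup E] [NormedSpace ℝ E] {M : Type*} [TopologicalSpace M]
  [ChartedSpace E M]

/-- `F` is a `G`-invariant smooth function on `M` which extends the function `f` on the fixed point
set near `x`. -/
structure IsInvariantExtension (G : Type*) [Group G] [MulAction G M] (x : M)
    (F : C^∞⟮𝓘(ℝ, E), M; ℝ⟯) (f : MulAction.fixedPoints G M → ℝ) : Prop where
  invariant : ∀ (g : G) (y : M), F (g • y) = F y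
  eventually_eq : ∀ᶠ y in 𝓝 x, ∀ hy : y ∈ MulAction.fixedPoints G M, F y = f ⟨y, hy⟩

namespace IsInvariantExtension

variable {G : Type*} [Group G] [MulAction G M] {x : M} {F K : C^∞⟮𝓘(ℝ, E), M; ℝ⟯}
  {f k : MulAction.fixedPoints G M → ℝ}

theorem add (hF : IsInvariantExtension G x F f) (hK : IsInvariantExtension G x K k) :
    IsInvariantExtension G x (F + K) (f + k) where
  invariant g y := by simp [hF.invariant, hK.invariant]
  eventually_eq := by
    filter_upwards [hF.eventually_eq, hK.eventually_eq] with y h1 h2 hy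
    simp [h1 hy, h2 hy]

theorem mul (hF : IsInvariantExtension G x F f) (hK : IsInvariantExtension G x K k) :
    IsInvariantExtension G x (F * K) (f * k) where
  invariant g y := by simp [hF.invariant, hK.invariant]
  eventually_eq := by
    filter_upwards [hF.eventually_eq, hK.eventually_eq] with y h1 h2 hy
    simp [h1 hy, h2 hy]

theorem smul (c : ℝ) (hF : IsInvariantExtension G x F f) :
    IsInvariantExtension G x (c • F) (c • f) where
  invariant g y := by simp [hF.invariant]
  eventually_eq := by
    filter_upwards [hF.eventually_eq] with y h1 hy
    simp [h1 hy]

theorem apply_eq (hF : IsInvariantExtension G x F f) (hx : x ∈ MulAction.fixedPoints G M) :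
    F x = f ⟨x, hx⟩ :=
  hF.eventually_eq.self_of_nhds hx

theorem eventually (hF : IsInvariantExtension G x F f) :
    ∀ᶠ y in 𝓝 x, IsInvariantExtension G y F f := by
  filter_upwards [eventually_eventually_nhds.2 hF.eventually_eq] with y hy
  exact ⟨hF.invariant, hy⟩

end IsInvariantExtension

theorem isInvariantExtension_restrict {G : Type*} [Group G] [MulAction G M]
    {F : C^∞⟮𝓘(ℝ, E), M; ℝ⟯}
    (hF : ∀ (g : G) (x : M), F (g • x) = F x) (x : M) :
    IsInvariantExtension G x F (restrict (MulAction.fixedPoints G M) F).1 :=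
  ⟨hF, Eventually.of_forall fun _ _ => rfl⟩

theorem ActsByPoissonAutomorphisms.contMDiff_smul {G : Type*} [Group G] [MulAction G M]
    {P : PoissonStructure C^∞⟮𝓘(ℝ, E), M; ℝ⟯} (hP : ActsByPoissonAutomorphisms G P) (g : G) :
    ContMDiff 𝓘(ℝ, E) 𝓘(ℝ, E) ∞ fun x : M => g • x := by
  obtain ⟨φ, hφ, -⟩ := hP g
  exact φ.contMDiff.congr fun x => (hφ x).symm

theorem ActsByPoissonAutomorphisms.bracket_invariant {G : Type*} [Group G] [MulAction G M]
    {P : PoissonStructure C^∞⟮𝓘(ℝ, E), M; ℝ⟯} (hP : ActsByPoissonAutomorphisms G P)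
    {F₁ F₂ : C^∞⟮𝓘(ℝ, E), M; ℝ⟯} (h₁ : ∀ (g : G) (x : M), F₁ (g • x) = F₁ x)
    (h₂ : ∀ (g : G) (x : M), F₂ (g • x) = F₂ x) (g : G) (x : M) :
    P.bracket F₁ F₂ (g • x) = P.bracket F₁ F₂ x := by
  obtain ⟨φ, hφ, hφP⟩ := hP g
  have hc : ∀ F : C^∞⟮𝓘(ℝ, E), M; ℝ⟯, (∀ (g : G) (x : M), F (g • x) = F x) →
      F.comp φ.toContMDiffMap = F := fun F hF => by
    ext y
    change F (φ y) = F y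
    rw [hφ, hF]
  have := hφP F₁ F₂
  rw [hc F₁ h₁, hc F₂ h₂] at this
  rw [← hφ]
  exact (congrArg (fun F : C^∞⟮𝓘(ℝ, E), M; ℝ⟯ => F x) this).symm

end InvariantExtension

/-! ### The Poisson structure on the fixed point set. -/

section FixedPointBracket

variable {E : Type*} [NormedAddCommGroup E] [NormedSpace ℝ E] [FiniteDimensional ℝ E]
  {M : Type*} [TopologicalSpace M] [T2Space M] [ChartedSpace E M] [IsManifold 𝓘(ℝ, E) ∞ M]
  {G : Type*} [Group G] [TopologicalSpace G] [IsTopologicalGroup G] [CompactSpace G]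
  [MulAction G M] [ContinuousSMul G M] {P : PoissonStructure C^∞⟮𝓘(ℝ, E), M; ℝ⟯}

theorem ActsByPoissonAutomorphisms.exists_isInvariantExtension
    (hP : ActsByPoissonAutomorphisms G P) (f : smoothFunctions E (MulAction.fixedPoints G M))
    (x : MulAction.fixedPoints G M) :
    ∃ F : C^∞⟮𝓘(ℝ, E), M; ℝ⟯, IsInvariantExtension G (x : M) F f.1 := by
  obtain ⟨F, h1, h2⟩ := exists_invariant_extension hP.contMDiff_smul f x.2
  exact ⟨F, h1, h2⟩

/-- One argument is replaced at a time: the difference of two extensions is invariant and vanishes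
on the fixed points near `x`, so the Hamiltonian derivation of the other argument kills it.
Skew-symmetry handles the first slot. -/
theorem ActsByPoissonAutomorphisms.bracket_congr (hP : ActsByPoissonAutomorphisms G P) {x : M}
    (hx : x ∈ MulAction.fixedPoints G M) {F₁ F₂ K₁ K₂ : C^∞⟮𝓘(ℝ, E), M; ℝ⟯}
    {f₁ f₂ : MulAction.fixedPoints G M → ℝ} (hF₁ : IsInvariantExtension G x F₁ f₁)
    (hF₂ : IsInvariantExtension G x F₂ f₂) (hK₁ : IsInvariantExtension G x K₁ f₁)
    (hK₂ : IsInvariantExtension G x K₂ f₂) : P.bracket F₁ F₂ x = P.bracket K₁ K₂ x := by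
  have key : ∀ {F K : C^∞⟮𝓘(ℝ, E), M; ℝ⟯} {f : MulAction.fixedPoints G M → ℝ}
      (L : C^∞⟮𝓘(ℝ, E), M; ℝ⟯), IsInvariantExtension G x F f → IsInvariantExtension G x K f →
      P.bracket L F x = P.bracket L K x := fun {F K f} L hF hK => by
    have := (isDerivationAt_hamiltonianAt P x L).apply_eq_zero_of_invariant hP.contMDiff_smul hx
      (F := F - K) (fun g y => by simp [hF.invariant, hK.invariant]) (by
        filter_upwards [hF.eventually_eq, hK.eventually_eq] with y h1 h2 hy
        simp [h1 hy, h2 hy])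
    rw [map_sub] at this
    exact sub_eq_zero.1 this
  rw [key F₁ hF₂ hK₂, P.skew F₁ K₂, P.skew K₁ K₂]
  simpa using key K₂ hF₁ hK₁

/-- The bracket on the fixed point set: the bracket of local invariant extensions. -/
noncomputable def fixedBracket (hP : ActsByPoissonAutomorphisms G P)
    (f₁ f₂ : smoothFunctions E (MulAction.fixedPoints G M)) (x : MulAction.fixedPoints G M) : ℝ :=
  P.bracket (hP.exists_isInvariantExtension f₁ x).choose
    (hP.exists_isInvariantExtension f₂ x).choose x

theorem fixedBracket_eq (hP : ActsByPoissonAutomorphisms G P)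
    {f₁ f₂ : smoothFunctions E (MulAction.fixedPoints G M)} (x : MulAction.fixedPoints G M)
    {F₁ F₂ : C^∞⟮𝓘(ℝ, E), M; ℝ⟯} (h₁ : IsInvariantExtension G (x : M) F₁ f₁.1)
    (h₂ : IsInvariantExtension G (x : M) F₂ f₂.1) :
    fixedBracket hP f₁ f₂ x = P.bracket F₁ F₂ x :=
  hP.bracket_congr x.2 (hP.exists_isInvariantExtension f₁ x).choose_spec
    (hP.exists_isInvariantExtension f₂ x).choose_spec h₁ h₂

/-- An extension at `x` is one at all nearby points, so the formula for the bracket holds on a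
neighbourhood. This gives smoothness of the bracket and makes iterated brackets computable on `M`,
as the Jacobi identity requires. -/
theorem isInvariantExtension_bracket (hP : ActsByPoissonAutomorphisms G P)
    {f₁ f₂ : smoothFunctions E (MulAction.fixedPoints G M)} {x : M}
    {F₁ F₂ : C^∞⟮𝓘(ℝ, E), M; ℝ⟯} (h₁ : IsInvariantExtension G x F₁ f₁.1)
    (h₂ : IsInvariantExtension G x F₂ f₂.1) :
    IsInvariantExtension G x (P.bracket F₁ F₂) (fixedBracket hP f₁ f₂) where
  invariant := hP.bracket_invariant h₁.invariant h₂.invariant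
  eventually_eq := by
    filter_upwards [h₁.eventually, h₂.eventually] with y h1 h2 hy
    exact (fixedBracket_eq hP ⟨y, hy⟩ h1 h2).symm

theorem fixedBracket_mem (hP : ActsByPoissonAutomorphisms G P)
    (f₁ f₂ : smoothFunctions E (MulAction.fixedPoints G M)) :
    fixedBracket hP f₁ f₂ ∈ smoothFunctions E (MulAction.fixedPoints G M) := by
  intro x
  obtain ⟨F₁, h₁⟩ := hP.exists_isInvariantExtension f₁ x
  obtain ⟨F₂, h₂⟩ := hP.exists_isInvariantExtension f₂ x
  obtain ⟨U, hUF, hU, hxU⟩ := mem_nhds_iff.1 (isInvariantExtension_bracket hP h₁ h₂).eventually_eq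
  exact ⟨U, hU, hxU, _, (P.bracket F₁ F₂).contMDiff.contMDiffOn, fun y hy => hUF hy y.2⟩

/-- The bracket on the fixed point set as a bilinear map. -/
noncomputable def fixedBracketBilin (hP : ActsByPoissonAutomorphisms G P) :
    smoothFunctions E (MulAction.fixedPoints G M) →ₗ[ℝ]
      smoothFunctions E (MulAction.fixedPoints G M) →ₗ[ℝ]
        smoothFunctions E (MulAction.fixedPoints G M) :=
  LinearMap.mk₂ ℝ (fun f₁ f₂ => ⟨fixedBracket hP f₁ f₂, fixedBracket_mem hP f₁ f₂⟩)
    (fun f f' k => by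
      ext x
      obtain ⟨F, hF⟩ := hP.exists_isInvariantExtension f x
      obtain ⟨F', hF'⟩ := hP.exists_isInvariantExtension f' x
      obtain ⟨K, hK⟩ := hP.exists_isInvariantExtension k x
      change fixedBracket hP _ _ x = fixedBracket hP _ _ x + fixedBracket hP _ _ x
      rw [fixedBracket_eq hP x (hF.add hF') hK, fixedBracket_eq hP x hF hK,
        fixedBracket_eq hP x hF' hK, map_add]
      rfl)
    (fun c f k => by
      ext x
      obtain ⟨F, hF⟩ := hP.exists_isInvariantExtension f x
      obtain ⟨K, hK⟩ := hP.exists_isInvariantExtension k x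
      change fixedBracket hP _ _ x = c * fixedBracket hP _ _ x
      rw [fixedBracket_eq hP x (hF.smul c) hK, fixedBracket_eq hP x hF hK, map_smul]
      rfl)
    (fun f k k' => by
      ext x
      obtain ⟨F, hF⟩ := hP.exists_isInvariantExtension f x
      obtain ⟨K, hK⟩ := hP.exists_isInvariantExtension k x
      obtain ⟨K', hK'⟩ := hP.exists_isInvariantExtension k' x
      change fixedBracket hP _ _ x = fixedBracket hP _ _ x + fixedBracket hP _ _ x
      rw [fixedBracket_eq hP x hF (hK.add hK'), fixedBracket_eq hP x hF hK,
        fixedBracket_eq hP x hF hK', map_add]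
      rfl)
    (fun c f k => by
      ext x
      obtain ⟨F, hF⟩ := hP.exists_isInvariantExtension f x
      obtain ⟨K, hK⟩ := hP.exists_isInvariantExtension k x
      change fixedBracket hP _ _ x = c * fixedBracket hP _ _ x
      rw [fixedBracket_eq hP x hF (hK.smul c), fixedBracket_eq hP x hF hK, map_smul]
      rfl)

theorem fixedBracketBilin_skew (hP : ActsByPoissonAutomorphisms G P)
    (f k : smoothFunctions E (MulAction.fixedPoints G M)) :
    fixedBracketBilin hP f k = -fixedBracketBilin hP k f := by
  ext x
  obtain ⟨F, hF⟩ := hP.exists_isInvariantExtension f x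
  obtain ⟨K, hK⟩ := hP.exists_isInvariantExtension k x
  change fixedBracket hP _ _ x = -fixedBracket hP _ _ x
  rw [fixedBracket_eq hP x hF hK, fixedBracket_eq hP x hK hF, P.skew]
  rfl

theorem fixedBracketBilin_leibniz (hP : ActsByPoissonAutomorphisms G P)
    (f k l : smoothFunctions E (MulAction.fixedPoints G M)) :
    fixedBracketBilin hP f (k * l) = fixedBracketBilin hP f k * l + k * fixedBracketBilin hP f l := by
  ext x
  obtain ⟨F, hF⟩ := hP.exists_isInvariantExtension f x
  obtain ⟨K, hK⟩ := hP.exists_isInvariantExtension k x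
  obtain ⟨L, hL⟩ := hP.exists_isInvariantExtension l x
  change fixedBracket hP _ _ x =
    fixedBracket hP _ _ x * l.1 x + k.1 x * fixedBracket hP _ _ x
  rw [fixedBracket_eq hP x hF (hK.mul hL), fixedBracket_eq hP x hF hK,
    fixedBracket_eq hP x hF hL, P.leibniz, ← hK.apply_eq x.2, ← hL.apply_eq x.2]
  rfl

theorem fixedBracketBilin_jacobi (hP : ActsByPoissonAutomorphisms G P)
    (f k l : smoothFunctions E (MulAction.fixedPoints G M)) :
    fixedBracketBilin hP f (fixedBracketBilin hP k l) + fixedBracketBilin hP k (fixedBracketBilin hP l f) +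
      fixedBracketBilin hP l (fixedBracketBilin hP f k) = 0 := by
  ext x
  obtain ⟨F, hF⟩ := hP.exists_isInvariantExtension f x
  obtain ⟨K, hK⟩ := hP.exists_isInvariantExtension k x
  obtain ⟨L, hL⟩ := hP.exists_isInvariantExtension l x
  have key : ∀ {f k l : smoothFunctions E (MulAction.fixedPoints G M)}
      {F K L : C^∞⟮𝓘(ℝ, E), M; ℝ⟯}, IsInvariantExtension G (x : M) F f.1 →
      IsInvariantExtension G (x : M) K k.1 → IsInvariantExtension G (x : M) L l.1 →
      fixedBracket hP f ⟨fixedBracket hP k l, fixedBracket_mem hP k l⟩ x =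
        P.bracket F (P.bracket K L) x := fun hF hK hL =>
    fixedBracket_eq hP x hF (isInvariantExtension_bracket hP hK hL)
  change fixedBracket hP f ⟨fixedBracket hP k l, fixedBracket_mem hP k l⟩ x +
    fixedBracket hP k ⟨fixedBracket hP l f, fixedBracket_mem hP l f⟩ x +
    fixedBracket hP l ⟨fixedBracket hP f k, fixedBracket_mem hP f k⟩ x = 0
  rw [key hF hK hL, key hK hL hF, key hL hF hK]
  exact congrArg (fun A : C^∞⟮𝓘(ℝ, E), M; ℝ⟯ => A x) (P.jacobi F K L)

/-- The Poisson structure on the fixed point set. -/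
noncomputable def fixedPoissonStructure (hP : ActsByPoissonAutomorphisms G P) :
    PoissonStructure (smoothFunctions E (MulAction.fixedPoints G M)) where
  bracket := fixedBracketBilin hP
  skew := fixedBracketBilin_skew hP
  leibniz := fixedBracketBilin_leibniz hP
  jacobi := fixedBracketBilin_jacobi hP

/-- The fixed point set of a compact group of Poisson automorphisms is an embedded submanifold with
a unique Poisson bracket for which the restriction of invariant functions preserves brackets. -/
theorem ActsByPoissonAutomorphisms.isEmbeddedSubmanifold_and_existsUnique
    (hP : ActsByPoissonAutomorphisms G P) :
    IsEmbeddedSubmanifold E (MulAction.fixedPoints G M) ∧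
      ∃! Q : PoissonStructure (smoothFunctions E (MulAction.fixedPoints G M)),
        ∀ F₁ F₂ : C^∞⟮𝓘(ℝ, E), M; ℝ⟯,
          (∀ (g : G) (x : M), F₁ (g • x) = F₁ x) → (∀ (g : G) (x : M), F₂ (g • x) = F₂ x) →
          restrict (MulAction.fixedPoints G M) (P.bracket F₁ F₂) =
            Q.bracket (restrict (MulAction.fixedPoints G M) F₁)
              (restrict (MulAction.fixedPoints G M) F₂) := by
  refine ⟨isEmbeddedSubmanifold_fixedPoints hP.contMDiff_smul, fixedPoissonStructure hP,
    fun F₁ F₂ h₁ h₂ => ?_, fun Q hQ => ?_⟩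
  · ext x
    exact (fixedBracket_eq hP x (isInvariantExtension_restrict h₁ x)
      (isInvariantExtension_restrict h₂ x)).symm
  -- By locality, `Q` may be evaluated at `x` on restrictions of invariant extensions, where its
  -- values are prescribed.
  · ext f k x
    obtain ⟨F, hF⟩ := hP.exists_isInvariantExtension f x
    obtain ⟨K, hK⟩ := hP.exists_isInvariantExtension k x
    change (Q.bracket f k).1 x = fixedBracket hP f k x
    rw [fixedBracket_eq hP x hF hK, ← Q.bracket_apply_congr (f₁ := restrict _ F)
      (f₂ := restrict _ K) x hF.eventually_eq hK.eventually_eq,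
      ← hQ F K hF.invariant hK.invariant]
    rfl

end FixedPointBracket

/-! ### Finite groups and involutions. -/

section FiniteGroup

variable {E : Type*} [NormedAddCommGroup E] [NormedSpace ℝ E] [FiniteDimensional ℝ E]
  {M : Type*} [TopologicalSpace M] [T2Space M] [ChartedSpace E M] [IsManifold 𝓘(ℝ, E) ∞ M]
  {P : PoissonStructure C^∞⟮𝓘(ℝ, E), M; ℝ⟯}

/-- With the discrete topology a finite group is compact and the action is jointly continuous. -/
theorem ActsByPoissonAutomorphisms.isEmbeddedSubmanifold_and_existsUnique_of_finite
    {G : Type*} [Group G] [Finite G] [MulAction G M] (hP : ActsByPoissonAutomorphisms G P) :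
    IsEmbeddedSubmanifold E (MulAction.fixedPoints G M) ∧
      ∃! Q : PoissonStructure (smoothFunctions E (MulAction.fixedPoints G M)),
        ∀ F₁ F₂ : C^∞⟮𝓘(ℝ, E), M; ℝ⟯,
          (∀ (g : G) (x : M), F₁ (g • x) = F₁ x) → (∀ (g : G) (x : M), F₂ (g • x) = F₂ x) →
          restrict (MulAction.fixedPoints G M) (P.bracket F₁ F₂) =
            Q.bracket (restrict (MulAction.fixedPoints G M) F₁)
              (restrict (MulAction.fixedPoints G M) F₂) := by
  let _ : TopologicalSpace G := ⊥
  have : DiscreteTopology G := ⟨rfl⟩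
  have : ContinuousSMul G M :=
    ⟨continuous_prod_of_discrete_left.2 fun g => (hP.contMDiff_smul g).continuous⟩
  exact hP.isEmbeddedSubmanifold_and_existsUnique

end FiniteGroup

section Involution

variable {E : Type*} [NormedAddCommGroup E] [NormedSpace ℝ E]
  {M : Type*} [TopologicalSpace M] [ChartedSpace E M]

theorem eq_one_or_eq_of_mem_zpowers {A : Type*} [Group A] {a b : A} (ha : a * a = 1)
    (hb : b ∈ Subgroup.zpowers a) : b = 1 ∨ b = a := by
  obtain ⟨k, rfl⟩ := Subgroup.mem_zpowers_iff.1 hb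
  have h2 : ∀ m : ℤ, a ^ (m + m) = 1 := fun m => by
    rw [← two_mul, zpow_mul, zpow_two, ha, one_zpow]
  rcases Int.even_or_odd' k with ⟨m, rfl | rfl⟩
  · left
    rw [two_mul, h2]
  · right
    rw [two_mul, zpow_add_one, h2, one_mul]

/-- The finite case is applied to the group of permutations generated by `φ`, which has at most two
elements; taking the generated subgroup also covers `φ = id`. Its fixed points and invariant
functions are those of `φ`. -/
theorem IsPoissonAutomorphism.isEmbeddedSubmanifold_and_existsUnique_of_involution [FiniteDimensional ℝ E] [T2Space M]
    [IsManifold 𝓘(ℝ, E) ∞ M] {P : PoissonStructure C^∞⟮𝓘(ℝ, E), M; ℝ⟯}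
    (φ : M ≃ₘ^∞⟮𝓘(ℝ, E), 𝓘(ℝ, E)⟯ M) (hφP : IsPoissonAutomorphism P φ)
    (hφ : ∀ x : M, φ (φ x) = x) :
    IsEmbeddedSubmanifold E {x : M | φ x = x} ∧
      ∃! Q : PoissonStructure (smoothFunctions E {x : M | φ x = x}),
        ∀ F₁ F₂ : C^∞⟮𝓘(ℝ, E), M; ℝ⟯,
          (∀ x : M, F₁ (φ x) = F₁ x) → (∀ x : M, F₂ (φ x) = F₂ x) →
          restrict {x : M | φ x = x} (P.bracket F₁ F₂) =
            Q.bracket (restrict {x : M | φ x = x} F₁) (restrict {x : M | φ x = x} F₂) := by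
  let a : Equiv.Perm M := φ.toEquiv
  have ha : a * a = 1 := Equiv.ext hφ
  let A := Subgroup.zpowers a
  have hA : ∀ g : A, (∀ x : M, g • x = x) ∨ ∀ x : M, g • x = φ x := fun g => by
    rcases eq_one_or_eq_of_mem_zpowers ha g.2 with h | h
    · exact Or.inl fun x => congrArg (fun e : Equiv.Perm M => e x) h
    · exact Or.inr fun x => congrArg (fun e : Equiv.Perm M => e x) h
  have hφA : ∀ x : M, (⟨a, Subgroup.mem_zpowers a⟩ : A) • x = φ x := fun x => rfl
  have : Finite A := finite_zpowers.2 (isOfFinOrder_iff_pow_eq_one.2 ⟨2, two_pos, by rw [pow_two, ha]⟩)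
  have hP : ActsByPoissonAutomorphisms A P := fun g => by
    rcases hA g with h | h
    · exact ⟨Diffeomorph.refl _ _ _, fun x => (h x).symm, fun F₁ F₂ => rfl⟩
    · exact ⟨φ, fun x => (h x).symm, hφP⟩
  have hfix : MulAction.fixedPoints A M = {x : M | φ x = x} := by
    ext x
    refine ⟨fun h => h ⟨a, Subgroup.mem_zpowers a⟩, fun h g => ?_⟩
    rcases hA g with hg | hg
    · exact hg x
    · exact (hg x).trans h
  have hinv : ∀ F : C^∞⟮𝓘(ℝ, E), M; ℝ⟯,
      (∀ (g : A) (x : M), F (g • x) = F x) ↔ ∀ x : M, F (φ x) = F x := fun F => by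
    refine ⟨fun h x => h ⟨a, Subgroup.mem_zpowers a⟩ x, fun h g x => ?_⟩
    rcases hA g with hg | hg
    · rw [hg]
    · rw [hg, h]
  have key := hP.isEmbeddedSubmanifold_and_existsUnique_of_finite
  simp only [hinv] at key
  rwa [hfix] at key

end Involution

end PoissonFixed

theorem theorem2p1
    {E : Type*} [NormedAddCommGroup E] [NormedSpace ℝ E] [FiniteDimensional ℝ E]
    {M : Type*} [TopologicalSpace M] [T2Space M] [SecondCountableTopology M]
    [ChartedSpace E M] [IsManifold 𝓘(ℝ, E) ∞ M]
    (P : PoissonFixed.PoissonStructure C^∞⟮𝓘(ℝ, E), M; ℝ⟯) :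
    -- compact groups
    (∀ (G : Type*) [Group G] [TopologicalSpace G] [IsTopologicalGroup G] [CompactSpace G]
        [MulAction G M] [ContinuousSMul G M],
      PoissonFixed.ActsByPoissonAutomorphisms G P →
        PoissonFixed.IsEmbeddedSubmanifold E (MulAction.fixedPoints G M) ∧
        ∃! Q : PoissonFixed.PoissonStructure
            (PoissonFixed.smoothFunctions E (MulAction.fixedPoints G M)),
          ∀ F₁ F₂ : C^∞⟮𝓘(ℝ, E), M; ℝ⟯,
            (∀ (g : G) (x : M), F₁ (g • x) = F₁ x) → (∀ (g : G) (x : M), F₂ (g • x) = F₂ x) →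
            PoissonFixed.restrict (MulAction.fixedPoints G M) (P.bracket F₁ F₂) =
              Q.bracket (PoissonFixed.restrict (MulAction.fixedPoints G M) F₁)
                (PoissonFixed.restrict (MulAction.fixedPoints G M) F₂)) ∧
    -- finite groups
    (∀ (G : Type*) [Group G] [Finite G] [MulAction G M],
      PoissonFixed.ActsByPoissonAutomorphisms G P →
        PoissonFixed.IsEmbeddedSubmanifold E (MulAction.fixedPoints G M) ∧
        ∃! Q : PoissonFixed.PoissonStructure
            (PoissonFixed.smoothFunctions E (MulAction.fixedPoints G M)),
          ∀ F₁ F₂ : C^∞⟮𝓘(ℝ, E), M; ℝ⟯,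
            (∀ (g : G) (x : M), F₁ (g • x) = F₁ x) → (∀ (g : G) (x : M), F₂ (g • x) = F₂ x) →
            PoissonFixed.restrict (MulAction.fixedPoints G M) (P.bracket F₁ F₂) =
              Q.bracket (PoissonFixed.restrict (MulAction.fixedPoints G M) F₁)
                (PoissonFixed.restrict (MulAction.fixedPoints G M) F₂)) ∧
    -- Poisson involutions
    (∀ φ : M ≃ₘ^∞⟮𝓘(ℝ, E), 𝓘(ℝ, E)⟯ M,
      PoissonFixed.IsPoissonAutomorphism P φ → (∀ x : M, φ (φ x) = x) →
        PoissonFixed.IsEmbeddedSubmanifold E {x : M | φ x = x} ∧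
        ∃! Q : PoissonFixed.PoissonStructure
            (PoissonFixed.smoothFunctions E {x : M | φ x = x}),
          ∀ F₁ F₂ : C^∞⟮𝓘(ℝ, E), M; ℝ⟯,
            (∀ x : M, F₁ (φ x) = F₁ x) → (∀ x : M, F₂ (φ x) = F₂ x) →
            PoissonFixed.restrict {x : M | φ x = x} (P.bracket F₁ F₂) =
              Q.bracket (PoissonFixed.restrict {x : M | φ x = x} F₁)
                (PoissonFixed.restrict {x : M | φ x = x} F₂)) := by
  refine ⟨fun G _ _ _ _ _ _ hP => hP.isEmbeddedSubmanifold_and_existsUnique,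
    fun G _ _ _ hP => hP.isEmbeddedSubmanifold_and_existsUnique_of_finite,
    fun φ hφP hφ => hφP.isEmbeddedSubmanifold_and_existsUnique_of_involution φ hφ⟩
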